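/- **Setting.** Let $\mathbf Z,\mathbf H,\mathbf X$ be real separable Hilbert spaces with $\dim\mathbf Z<\infty$, and let $\iota:\mathbf H\to\mathbf X$ be an injective Hilbert–Schmidt operator (we regard $\mathbf H\subset\mathbf X$ through $\iota$). Let $\mathcal H_A\in C^2(\mathbf Z;\mathbb R)$ have gradient $\mathrm D\mathcal H_A$, and for $z\in\mathbf Z$ let $\mathbb J_A(z):\mathbf Z\to\mathbf Z$ be linear and skew-adjoint, where $z\mapsto\mathbb J_A(z)$ is bounded and locally Lipschitz (for instance constant, or of class $C^1_b$). Let $(e^{t\mathbb J_B})_{t\in\mathbb R}$ be the strongly continuous unitary group on $\mathbf H$ with generator $\mathbb J_B$, and assume that it extends to a strongly continuous group $(\widehat S_t)_{t\in\mathbb R}$ of bounded linear operators on $\mathbf X$. Let $\mathbf W\subset\mathbf H$ be a finite-dimensional subspace with orthogonal projection $\mathbb P:\mathbf H\to\mathbf W$, and let $\mathsf C:\mathbf Z\to\mathbf H$ be linear with range in $\mathbf W$. For $\beta>0$ let $\gamma_\beta=\mathcal N_{\mathbf X}(0,\beta^{-1}\iota\iota^*)$ be the centered Gaussian measure on $\mathbf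 X$ with covariance operator $\beta^{-1}\iota\iota^*$, and let $\mathcal B(\mathbf X)_{\gamma_\beta}$ be the $\gamma_\beta$-completion of the Borel $\sigma$-algebra $\mathcal B(\mathbf X)$. Let $\widehat{\mathbb P}:\mathbf X\to\mathbf W$ be a measurable linear extension of $\mathbb P$, i.e. a $\mathcal B(\mathbf X)_{\gamma_\beta}$-measurable map that equals $\mathbb P$ on $\mathbf H$ and is linear on some subspace $\mathbf L$ with $\mathbf H\subset\mathbf L\subset\mathbf X$ and $\gamma_\beta(\mathbf L)=1$. Put $\widehat{\mathbb Q}=\mathrm{id}-\widehat{\mathbb P}$ and $\widehat{\mathsf C}^*=\mathsf C^*\widehat{\mathbb P}$. **Theorem.** Assume that $\mathrm D\mathcal H_A$ is globally Lipschitz on $\mathbf Z$. Then there is a family of maps $\mathbb U_t:\mathbf Z\times\mathbf X\to\mathbf Z\times\mathbf X$, $t\in\mathbb R$, with the following properties. 1. For every $(z_0,\eta_0)\in\mathbf Z\times\mathbf H$ the curve $(z_t,\eta_t):=\mathbb U_t(z_0,\eta_0)$ starts at $(z_0,\eta_0)$ for $t=0$, satisfies $z\in C^1(\mathbb R;\mathbf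 Z)$ and $\eta\in C(\mathbb R;\mathbf H)$, and for all $t\in\mathbb R$ $$\dot z_t=\mathbb J_A(z_t)\big(\mathrm D\mathcal H_A(z_t)+\mathsf C^*\eta_t\big),\qquad \eta_t=e^{t\mathbb J_B}(\eta_0+\mathsf Cz_0)-\mathsf Cz_t+\int_0^t e^{(t-s)\mathbb J_B}\mathsf C\dot z_s\,ds .$$ 2. For every $z_0\in\mathbf Z$ and $\gamma_\beta$-a.e. $\eta_0\in\mathbf X$ the curve $(z_t,\eta_t):=\mathbb U_t(z_0,\eta_0)$ starts at $(z_0,\eta_0)$ for $t=0$, satisfies $z\in W^{1,2}_{\mathrm{loc}}(\mathbb R;\mathbf Z)$ (with $z$ continuous) and $\eta\in C(\mathbb R;\mathbf X)$, and $$\dot z_t=\mathbb J_A(z_t)\big(\mathrm D\mathcal H_A(z_t)+\widehat{\mathsf C}^*\eta_t\big)\ \text{ for a.e. }t\in\mathbb R,\qquad \eta_t=\widehat S_t(\eta_0+\mathsf Cz_0)-\mathsf Cz_t+\int_0^t e^{(t-s)\mathbb J_B}\mathsf C\dot z_s\,ds\ \text{ for all }t\in\mathbb R .$$ Moreover, for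 every fixed $z_0$, the map $(t,\eta_0)\mapsto\mathbb U_t(z_0,\eta_0)$ is $\mathcal B(\mathbb R)\otimes\mathcal B(\mathbf X)_{\gamma_\beta}$-measurable; that is, for $\eta_0\sim\gamma_\beta$ one obtains a measurable $\mathbf Z\times\mathbf X$-valued process on $(\mathbf X,\mathcal B(\mathbf X)_{\gamma_\beta},\gamma_\beta)$. 3. For all $z_0\in\mathbf Z$ and $w_0\in\mathbf W$, and for $\widehat{\mathbb Q}_\#\gamma_\beta$-a.e. $\xi_0$, the curve $(z_t,\eta_t):=\mathbb U_t(z_0,w_0+\xi_0)$ has the initial value, the regularity and the equations of part 2 with $\eta_0=w_0+\xi_0$. Moreover $(t,\eta)\mapsto\mathbb U_t(z_0,w_0+\widehat{\mathbb Q}\eta)$ is $\mathcal B(\mathbb R)\otimes\mathcal B(\mathbf X)_{\gamma_\beta}$-measurable; that is, $\xi_0=\widehat{\mathbb Q}\eta$ with $\eta\sim\gamma_\beta$ again gives a measurable process on $(\mathbf X,\mathcal B(\mathbf X)_{\gamma_\beta},\gamma_\beta)$. -/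

import Mathlib

open MeasureTheory ProbabilityTheory
open scoped InnerProductSpace NNReal

noncomputable section

/-- A strongly continuous one-parameter group of bounded linear operators. -/
structure IsStronglyContinuousGroup {E : Type*} [NormedAddCommGroup E] [NormedSpace ℝ E]
    (T : ℝ → E →L[ℝ] E) : Prop where
  zero : T 0 = ContinuousLinearMap.id ℝ E
  add : ∀ s t, T (s + t) = (T s).comp (T t)
  continuous : ∀ x, Continuous fun t => T t x

/-- `S t = exp (t JB)`: a strongly continuous unitary group with infinitesimal generator `JB`
(by Stone's theorem, exactly the groups generated by densely defined skew-adjoint operators). -/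
structure IsUnitaryGroupGeneratedBy {H : Type*} [NormedAddCommGroup H] [InnerProductSpace ℝ H]
    [CompleteSpace H] (S : ℝ → H →L[ℝ] H) (JB : H →ₗ.[ℝ] H) : Prop where
  group : IsStronglyContinuousGroup S
  unitary : ∀ t, S t ∈ unitary (H →L[ℝ] H)
  generator : ∀ h k, (h, k) ∈ JB.graph ↔ HasDerivAt (fun t => S t h) k 0

/-- Hilbert-Schmidt operators between Hilbert spaces. -/
def IsHilbertSchmidt {H X : Type*} [NormedAddCommGroup H] [InnerProductSpace ℝ H]
    [NormedAddCommGroup X] [InnerProductSpace ℝ X] (T : H →L[ℝ] X) : Prop :=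
  ∃ (s : Set H) (b : HilbertBasis s ℝ H), Summable fun i => ‖T (b i)‖ ^ 2

/-- `γ` is the centered Gaussian measure `N(0, K)` on the Hilbert space `X` with covariance
operator `K`: every functional `⟪x, ·⟫` has law `N(0, ⟪K x, x⟫)`. -/
def IsCenteredGaussian {X : Type*} [NormedAddCommGroup X] [InnerProductSpace ℝ X]
    [MeasurableSpace X] (γ : Measure X) (K : X →L[ℝ] X) : Prop :=
  ∀ x : X, γ.map (fun η => ⟪x, η⟫_ℝ) = gaussianReal 0 (Real.toNNReal ⟪K x, x⟫_ℝ)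

/-- `fhat` is a `γ`-measurable linear extension of `f : H → Y` along the embedding `ι : H → X`:
it is linear on a subspace `L ⊇ ι H` of full measure, measurable for the `γ`-completed Borel
σ-algebra, and equal to `f` on `H`. Its values off `L` are irrelevant. -/
structure IsMeasurableLinearExtension {H X Y : Type*} [NormedAddCommGroup H]
    [InnerProductSpace ℝ H] [NormedAddCommGroup X] [InnerProductSpace ℝ X] [MeasurableSpace X]
    [NormedAddCommGroup Y] [NormedSpace ℝ Y] [MeasurableSpace Y]
    (γ : Measure X) (ι : H →L[ℝ] X) (f : H → Y) (fhat : X → Y) : Prop where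
  linear : ∃ L : Submodule ℝ X, (∀ h, ι h ∈ L) ∧ (∀ᵐ η ∂γ, η ∈ L) ∧
    (∀ x ∈ L, ∀ y ∈ L, fhat (x + y) = fhat x + fhat y) ∧
    (∀ (c : ℝ), ∀ x ∈ L, fhat (c • x) = c • fhat x)
  measurable : NullMeasurable fhat γ
  extends_map : ∀ h, fhat (ι h) = f h

/-- The extension `id - Phat` of the complementary projection. -/
def complProj {H X : Type*} [NormedAddCommGroup H] [InnerProductSpace ℝ H]
    [NormedAddCommGroup X] [InnerProductSpace ℝ X] {W : Submodule ℝ H}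
    (ι : H →L[ℝ] X) (Phat : X → W) (η : X) : X :=
  η - ι (Phat η : H)

/-- `f ∈ L²_loc(ℝ; E)`. -/
def MemL2Loc {E : Type*} [NormedAddCommGroup E] (f : ℝ → E) : Prop :=
  ∀ K : Set ℝ, IsCompact K → MemLp f 2 (volume.restrict K)

/-- `z` is (the continuous representative of) an element of `W^{1,2}_loc(ℝ; E)`, with weak
derivative `v`. -/
structure IsW12LocWithDeriv {E : Type*} [NormedAddCommGroup E] [NormedSpace ℝ E]
    (z v : ℝ → E) : Prop where
  continuous : Continuous z
  memL2 : MemL2Loc z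
  deriv_memL2 : MemL2Loc v
  weak_deriv : ∀ φ : ℝ → ℝ, ContDiff ℝ (⊤ : ℕ∞) φ → HasCompactSupport φ →
    ∫ t, deriv φ t • z t = -∫ t, φ t • v t

/-- Mild solutions with finite energy. -/
structure IsFiniteEnergySolution {Z H : Type*}
    [NormedAddCommGroup Z] [InnerProductSpace ℝ Z] [CompleteSpace Z]
    [NormedAddCommGroup H] [InnerProductSpace ℝ H] [CompleteSpace H]
    (HA : Z → ℝ) (JA : Z → Z →L[ℝ] Z) (C : Z →L[ℝ] H) (S : ℝ → H →L[ℝ] H)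
    (z₀ : Z) (η₀ : H) (z : ℝ → Z) (η : ℝ → H) : Prop where
  init_z : z 0 = z₀
  init_η : η 0 = η₀
  z_contDiff : ContDiff ℝ 1 z
  η_continuous : Continuous η
  z_eq : ∀ t, deriv z t = JA (z t) (gradient HA (z t) + C.adjoint (η t))
  η_eq : ∀ t, η t = S t (η₀ + C z₀) - C (z t) + ∫ s in (0 : ℝ)..t, S (t - s) (C (deriv z s))

/-- Solutions of the extended equations, with heat bath state in `X`; here
`C.adjoint (Phat η)` is the extension to `X` of the map `η ↦ C.adjoint η` on `H`. -/
structure IsExtendedSolution {Z H X : Type*}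
    [NormedAddCommGroup Z] [InnerProductSpace ℝ Z] [CompleteSpace Z]
    [NormedAddCommGroup H] [InnerProductSpace ℝ H] [CompleteSpace H]
    [NormedAddCommGroup X] [InnerProductSpace ℝ X]
    (HA : Z → ℝ) (JA : Z → Z →L[ℝ] Z) (C : Z →L[ℝ] H) (S : ℝ → H →L[ℝ] H)
    (ι : H →L[ℝ] X) (Shat : ℝ → X →L[ℝ] X) {W : Submodule ℝ H} (Phat : X → W)
    (z₀ : Z) (η₀ : X) (z : ℝ → Z) (η : ℝ → X) : Prop where
  init_z : z 0 = z₀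
  init_η : η 0 = η₀
  η_continuous : Continuous η
  exists_deriv : ∃ v : ℝ → Z, IsW12LocWithDeriv z v ∧
    (∀ᵐ t : ℝ, v t = JA (z t) (gradient HA (z t) + C.adjoint (Phat (η t) : H))) ∧
    (∀ t, η t = Shat t (η₀ + ι (C z₀)) - ι (C (z t))
      + ι (∫ s in (0 : ℝ)..t, S (t - s) (C (v s))))

/-- The process `(t, ω) ↦ V t ω` on `(Ω, 𝓑_γ, γ)`, with `𝓑_γ` the `γ`-completed σ-algebra, is
jointly measurable. -/
def IsMeasurableProcess {Ω E : Type*} [MeasurableSpace Ω] [MeasurableSpace E]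
    (γ : Measure Ω) (V : ℝ → Ω → E) : Prop :=
  Measurable fun p : ℝ × NullMeasurableSpace Ω γ => V p.1 p.2

end

/-! ### Ordinary differential equations with square integrable coefficients in time. -/

section Caratheodory

open Filter Topology Set

variable {E : Type*} [NormedAddCommGroup E]

/-! Write the bath state as `η_t = Ŝ_t η₀ + y_t`. The free evolution acts on system A only through
the force `f(t) = Ĉ*(Ŝ_t η₀)`, while the response `y` starts at 0 and stays in `H`. In the
interaction picture `u = S(-t)(y + C z)` the generator of the bath disappears and `(z, u)` solves an
ODE in `Z × H`. Its field has linear growth and is locally Lipschitz in space, with coefficients in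
`L²_loc` in time as soon as `f ∈ L²_loc`. Picard iteration then converges for all times
(`tendsto_picardIter`, `picardLimit_eq`).

For data in `H` the force is continuous, so `z` is `C¹`. For random data, `Ŝ_t` preserves `γ`
because it extends a unitary operator on `H` (`IsCenteredGaussian.measurePreserving`), and the
measurable linear map `P̂` has second moments by Fernique (`memLp_two`). Fubini gives, for a.e.
`η₀`, both `f ∈ L²_loc` and `Ŝ_t η₀` in the domain of linearity of `P̂` for a.e. `t`; such `η₀` are
called admissible. Admissibility survives every shift by a vector of `H`. Since `w₀ + Q̂η` is `η`
shifted by `w₀ - P̂η`, data with fixed observable part need no separate analysis.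

The flow is an explicit limit of Picard iterates, so it inherits their measurability; uniqueness of
solutions is never needed. -/

lemma MemL2Loc.locallyIntegrable {f : ℝ → E} (hf : MemL2Loc f) : LocallyIntegrable f volume := by
  rw [locallyIntegrable_iff]
  intro K hK
  have : IsFiniteMeasure (volume.restrict K) := ⟨by simpa using hK.measure_lt_top⟩
  exact (hf K hK).integrable (by norm_num)

lemma MemL2Loc.of_norm_le {F : Type*} [NormedAddCommGroup F] {f : ℝ → E} {g : ℝ → F}
    (hg : MemL2Loc g) (hf : AEStronglyMeasurable f volume)
    (h : ∀ t, ‖f t‖ ≤ ‖g t‖) : MemL2Loc f := fun K hK =>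
  (hg K hK).of_le hf.restrict (ae_of_all _ h)

lemma Continuous.memL2Loc {f : ℝ → E} (hf : Continuous f) : MemL2Loc f := fun K hK => by
  have : IsFiniteMeasure (volume.restrict K) := ⟨by simpa using hK.measure_lt_top⟩
  obtain ⟨M, hM⟩ := hK.exists_bound_of_continuousOn hf.continuousOn
  exact MemLp.of_bound hf.aestronglyMeasurable M
    ((ae_restrict_iff' hK.measurableSet).2 (ae_of_all _ hM))

lemma MemL2Loc.add {f g : ℝ → E} (hf : MemL2Loc f) (hg : MemL2Loc g) :
    MemL2Loc (fun t => f t + g t) := fun K hK => (hf K hK).add (hg K hK)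

lemma MemL2Loc.congr_ae {f g : ℝ → E} (hf : MemL2Loc f) (h : f =ᵐ[volume] g) : MemL2Loc g :=
  fun K hK => (hf K hK).ae_eq (ae_restrict_of_ae h)

lemma MemL2Loc.intervalIntegrable_sq {a : ℝ → ℝ} (ha : MemL2Loc a) (s t : ℝ) :
    IntervalIntegrable (fun r => a r ^ 2) volume s t := by
  have h := (ha (uIcc s t) isCompact_uIcc).integrable_sq
  exact (intervalIntegrable_iff_integrableOn_Icc_of_le (by simp)).2 h |>.mono_set (by
    rw [uIcc_of_le (by simp : min s t ≤ max s t)]; rfl)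

lemma abs_intervalIntegral_mul_exp_abs {c : ℝ} (t : ℝ) :
    |∫ s in (0 : ℝ)..t, c * Real.exp (c * |s|)| = |Real.exp (c * |t|) - 1| := by
  have key : ∀ t : ℝ, 0 ≤ t → ∫ s in (0 : ℝ)..t, c * Real.exp (c * |s|) = Real.exp (c * t) - 1 := by
    intro t ht
    have h1 : ∫ s in (0 : ℝ)..t, c * Real.exp (c * |s|)
        = ∫ s in (0 : ℝ)..t, c * Real.exp (c * s) := by
      apply intervalIntegral.integral_congr
      intro s hs
      rw [uIcc_of_le ht] at hs
      simp [abs_of_nonneg hs.1]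
    rw [h1, intervalIntegral.integral_eq_sub_of_hasDerivAt (f := fun s => Real.exp (c * s))]
    · simp
    · intro s _
      have := ((hasDerivAt_id s).const_mul c).exp
      simpa [mul_comm] using this
    · exact (by fun_prop : Continuous fun s : ℝ => c * Real.exp (c * s)).intervalIntegrable _ _
  rcases le_total 0 t with ht | ht
  · rw [key t ht, abs_of_nonneg ht]
  · have h2 : ∫ s in (0 : ℝ)..t, c * Real.exp (c * |s|)
        = - ∫ s in (0 : ℝ)..(-t), c * Real.exp (c * |s|) := by
      rw [← intervalIntegral.integral_symm]
      have := intervalIntegral.integral_comp_neg (a := 0) (b := -t)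
        (fun s : ℝ => c * Real.exp (c * |s|))
      simp only [abs_neg, neg_neg, neg_zero] at this
      rw [intervalIntegral.integral_symm, ← this, ← intervalIntegral.integral_symm]
    rw [h2, key (-t) (by linarith), abs_neg, abs_of_nonpos ht]

lemma abs_intervalIntegral_le_of_abs_le {f g : ℝ → ℝ} {t : ℝ}
    (hg : IntervalIntegrable g volume 0 t) (h : ∀ s, |s| ≤ |t| → |f s| ≤ g s) :
    |∫ s in (0 : ℝ)..t, f s| ≤ |∫ s in (0 : ℝ)..t, g s| := by
  have := intervalIntegral.norm_integral_le_abs_of_norm_le (f := f) (g := g) (a := 0) (b := t)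
    (μ := volume) ?_ hg
  · simpa using this
  · refine (ae_restrict_iff' measurableSet_uIoc).2 (ae_of_all _ fun s hs => h s ?_)
    have := uIoc_subset_uIcc hs
    simpa using abs_sub_left_of_mem_uIcc this

lemma MeasureTheory.LocallyIntegrable.abs_intervalIntegral_le {a : ℝ → ℝ}
    (ha : LocallyIntegrable a volume) (hn : ∀ t, 0 ≤ a t) {t T : ℝ} (ht : |t| ≤ T) :
    |∫ s in (0 : ℝ)..t, a s| ≤ ∫ s in (-T)..T, a s := by
  have h := abs_le.1 ht
  have h0 : -T ≤ T := by linarith [abs_nonneg t]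
  rw [intervalIntegral.abs_integral_eq_abs_integral_uIoc, abs_of_nonneg (integral_nonneg hn),
    intervalIntegral.integral_of_le h0]
  refine setIntegral_mono_set ?_ (ae_of_all _ hn) (LE.le.eventuallyLE ?_)
  · exact (ha.integrableOn_isCompact isCompact_Icc).mono_set Ioc_subset_Icc_self
  · exact Ioc_subset_Ioc (le_min (by linarith [abs_nonneg t]) h.1)
      (max_le (by linarith [abs_nonneg t]) h.2)

/-- A square integrable kernel is a contraction in a suitable exponentially weighted sup norm. -/
lemma exists_exp_weight {a : ℝ → ℝ} (ha : MemL2Loc a) (L T : ℝ) :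
    ∃ c : ℝ, 0 ≤ c ∧ ∀ t, |t| ≤ T →
      |∫ s in (0 : ℝ)..t, L * a s * Real.exp (c * |s|)| ≤ 1 / 2 * Real.exp (c * |t|) := by
  set A := |∫ s in (-T)..T, a s ^ 2| with hA
  have hA0 : 0 ≤ A := abs_nonneg _
  -- Young's inequality with `4δB = L²` splits the integrand. The choice of `δ` makes the part with
  -- `a²` at most `e/4`, and `c ≥ 2B` does the same for the exponential part.
  set δ := 1 / (4 * (A + 1)) with hδ
  have hδ0 : 0 < δ := by positivity
  set B := L ^ 2 / (4 * δ) with hB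
  have hB0 : 0 ≤ B := by positivity
  refine ⟨2 * B + 1, by positivity, fun t ht => ?_⟩
  set c := 2 * B + 1 with hc
  have hc0 : 0 < c := by positivity
  set e := Real.exp (c * |t|) with he
  have he0 : 0 < e := Real.exp_pos _
  have hint1 := (ha.intervalIntegrable_sq 0 t).const_mul (δ * e)
  have hint2 : IntervalIntegrable (fun s => B / e / (2 * c) * (2 * c * Real.exp (2 * c * |s|)))
      volume 0 t := (by fun_prop : Continuous _).intervalIntegrable _ _
  calc |∫ s in (0 : ℝ)..t, L * a s * Real.exp (c * |s|)|
      ≤ |∫ s in (0 : ℝ)..t, (δ * e * a s ^ 2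
          + B / e / (2 * c) * (2 * c * Real.exp (2 * c * |s|)))| := by
        refine abs_intervalIntegral_le_of_abs_le (hint1.add hint2) fun s _ => ?_
        have h1 : Real.exp (2 * c * |s|) = Real.exp (c * |s|) ^ 2 := by
          rw [← Real.exp_nat_mul]; congr 1; push_cast; ring
        rw [h1]
        set x := Real.exp (c * |s|)
        have h2 : B / e / (2 * c) * (2 * c * x ^ 2) = B / e * x ^ 2 := by field_simp
        rw [h2]
        have h3 : L ^ 2 = 4 * δ * B := by rw [hB]; field_simp
        refine abs_le_of_sq_le_sq ?_ (by positivity)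
        have h4 : (L * a s * x) ^ 2 = 4 * (δ * e * a s ^ 2) * (B / e * x ^ 2) := by
          rw [mul_pow, mul_pow, h3]; field_simp
        rw [h4]
        nlinarith [sq_nonneg (δ * e * a s ^ 2 - B / e * x ^ 2)]
    _ ≤ δ * e * |∫ s in (0 : ℝ)..t, a s ^ 2|
          + B / e / (2 * c) * |∫ s in (0 : ℝ)..t, 2 * c * Real.exp (2 * c * |s|)| := by
        rw [intervalIntegral.integral_add hint1 hint2, intervalIntegral.integral_const_mul,
          intervalIntegral.integral_const_mul]
        refine (abs_add_le _ _).trans (le_of_eq ?_)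
        rw [abs_mul, abs_mul (B / e / (2 * c)), abs_of_pos (by positivity : 0 < δ * e),
          abs_of_nonneg (by positivity : 0 ≤ B / e / (2 * c))]
    _ ≤ δ * e * A + B / e / (2 * c) * e ^ 2 := by
        gcongr
        · refine (LocallyIntegrable.abs_intervalIntegral_le (a := fun s => a s ^ 2) ?_
            (fun s => sq_nonneg _) ht).trans (le_abs_self _)
          rw [locallyIntegrable_iff]
          exact fun K hK => (ha K hK).integrable_sq
        · rw [abs_intervalIntegral_mul_exp_abs]
          have h1 : Real.exp (2 * c * |t|) = e ^ 2 := by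
            rw [he, ← Real.exp_nat_mul]; congr 1; push_cast; ring
          rw [h1, abs_of_nonneg]
          · linarith
          · have : 1 ≤ e := Real.one_le_exp (by positivity)
            nlinarith
    _ = (δ * A + B / (2 * c)) * e := by field_simp
    _ ≤ 1 / 2 * e := by
        gcongr
        have h1 : δ * A ≤ 1 / 4 := by
          rw [hδ, one_div_mul_eq_div, div_le_iff₀ (by positivity)]; linarith
        have h2 : B / (2 * c) ≤ 1 / 4 := by
          rw [div_le_iff₀ (by positivity)]; linarith
        linarith

/-- A time-dependent vector field of linear growth which is locally Lipschitz in space, both with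
square integrable coefficients in time. -/
structure IsCaratheodoryField (F : ℝ → E → E) (a : ℝ → ℝ) (K : ℝ) : Prop where
  growth_nonneg : 0 ≤ K
  memL2Loc : MemL2Loc a
  aestronglyMeasurable : ∀ x : ℝ → E, Continuous x →
    AEStronglyMeasurable (fun t => F t (x t)) volume
  growth : ∀ t x, ‖F t x‖ ≤ a t + K * ‖x‖
  lipschitz : ∀ R, ∃ L, 0 ≤ L ∧ ∀ t x y, ‖x‖ ≤ R → ‖y‖ ≤ R → ‖F t x - F t y‖ ≤ L * a t * ‖x - y‖

namespace IsCaratheodoryField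

variable {F : ℝ → E → E} {a : ℝ → ℝ} {K : ℝ}

lemma nonneg (hF : IsCaratheodoryField F a K) (t : ℝ) : 0 ≤ a t := by
  simpa using (norm_nonneg _).trans (hF.growth t 0)

lemma memL2Loc_comp (hF : IsCaratheodoryField F a K) {x : ℝ → E} (hx : Continuous x) :
    MemL2Loc fun t => F t (x t) :=
  (hF.memL2Loc.add (g := fun t => K * ‖x t‖)
    (by fun_prop : Continuous fun t => K * ‖x t‖).memL2Loc).of_norm_le
    (hF.aestronglyMeasurable x hx) fun t => (hF.growth t _).trans (le_abs_self _)

lemma intervalIntegrable_comp (hF : IsCaratheodoryField F a K) {x : ℝ → E} (hx : Continuous x)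
    (s t : ℝ) : IntervalIntegrable (fun r => F r (x r)) volume s t :=
  ((hF.memL2Loc_comp hx).locallyIntegrable.integrableOn_isCompact isCompact_uIcc).intervalIntegrable

end IsCaratheodoryField

variable [NormedSpace ℝ E]

/-- Picard iterates of the initial value problem `x' = F t x`, `x 0 = x₀`. -/
noncomputable def picardIter (F : ℝ → E → E) (x₀ : E) : ℕ → ℝ → E
  | 0 => fun _ => x₀
  | n + 1 => fun t => x₀ + ∫ s in (0 : ℝ)..t, F s (picardIter F x₀ n s)

/-- The pointwise limit of the Picard iterates. -/
noncomputable def picardLimit (F : ℝ → E → E) (x₀ : E) (t : ℝ) : E :=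
  @limUnder _ _ _ ⟨x₀⟩ atTop fun n => picardIter F x₀ n t

/-- Iterates see the field only through time integrals. This allows the force to be replaced by a
Borel version that agrees with it at almost every time. -/
lemma picardIter_congr_ae {F G : ℝ → E → E} (h : ∀ᵐ t, ∀ x, F t x = G t x) (x₀ : E)
    (n : ℕ) (t : ℝ) :
    picardIter F x₀ n t = picardIter G x₀ n t := by
  induction n generalizing t with
  | zero => rfl
  | succ n ih =>
    simp only [picardIter]
    congr 1
    refine intervalIntegral.integral_congr_ae ?_
    filter_upwards [h] with s hs _
    rw [hs, ih]

namespace IsCaratheodoryField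

variable {F : ℝ → E → E} {a : ℝ → ℝ} {K : ℝ}

lemma continuous_picardIter (hF : IsCaratheodoryField F a K) (x₀ : E) (n : ℕ) :
    Continuous (picardIter F x₀ n) := by
  induction n with
  | zero => exact continuous_const
  | succ n ih =>
    exact continuous_const.add
      (intervalIntegral.continuous_primitive (hF.intervalIntegrable_comp ih) 0)

/-- Gronwall in inductive form: the bound `B * exp (K|t|)` reproduces itself under the Picard map.
Being independent of `n`, it confines all iterates to one ball, so that one local Lipschitz constant
serves them all. -/
lemma norm_picardIter_le (hF : IsCaratheodoryField F a K) (x₀ : E) (n : ℕ) {t T : ℝ}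
    (ht : |t| ≤ T) :
    ‖picardIter F x₀ n t‖ ≤ (‖x₀‖ + ∫ s in (-T)..T, a s) * Real.exp (K * |t|) := by
  set B := ‖x₀‖ + ∫ s in (-T)..T, a s with hB
  have hT : -T ≤ T := by linarith [abs_nonneg t]
  have hA : 0 ≤ ∫ s in (-T)..T, a s := intervalIntegral.integral_nonneg hT fun s _ => hF.nonneg s
  have hB0 : 0 ≤ B := by positivity
  have hK := hF.growth_nonneg
  have hexp : ∀ t : ℝ, 1 ≤ Real.exp (K * |t|) := fun t => Real.one_le_exp (by positivity)
  induction n generalizing t with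
  | zero =>
    have : ‖x₀‖ ≤ B := by rw [hB]; linarith
    exact this.trans (le_mul_of_one_le_right hB0 (hexp t))
  | succ n ih =>
    have hi1 : IntervalIntegrable a volume 0 t :=
      (hF.memL2Loc.locallyIntegrable.integrableOn_isCompact isCompact_uIcc).intervalIntegrable
    have hi2 : IntervalIntegrable (fun s => B * (K * Real.exp (K * |s|))) volume 0 t :=
      (by fun_prop : Continuous _).intervalIntegrable _ _
    have h1 : ‖∫ s in (0 : ℝ)..t, F s (picardIter F x₀ n s)‖
        ≤ |∫ s in (0 : ℝ)..t, (a s + B * (K * Real.exp (K * |s|)))| := by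
      refine intervalIntegral.norm_integral_le_abs_of_norm_le ?_ (hi1.add hi2)
      refine (ae_restrict_iff' measurableSet_uIoc).2 (ae_of_all _ fun s hs => ?_)
      have hs' : |s| ≤ |t| := by simpa using abs_sub_left_of_mem_uIcc (uIoc_subset_uIcc hs)
      refine (hF.growth s _).trans ?_
      have := mul_le_mul_of_nonneg_left (ih (hs'.trans ht)) hK
      linarith
    have h2 : |∫ s in (0 : ℝ)..t, (a s + B * (K * Real.exp (K * |s|)))|
        ≤ (∫ s in (-T)..T, a s) + B * (Real.exp (K * |t|) - 1) := by
      rw [intervalIntegral.integral_add hi1 hi2, intervalIntegral.integral_const_mul]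
      refine (abs_add_le _ _).trans (add_le_add
        (LocallyIntegrable.abs_intervalIntegral_le hF.memL2Loc.locallyIntegrable hF.nonneg ht) ?_)
      rw [abs_mul, abs_intervalIntegral_mul_exp_abs, abs_of_nonneg hB0,
        abs_of_nonneg (by linarith [hexp t])]
    calc ‖picardIter F x₀ (n + 1) t‖ ≤ ‖x₀‖ + ‖∫ s in (0 : ℝ)..t, F s (picardIter F x₀ n s)‖ :=
          norm_add_le _ _
      _ ≤ ‖x₀‖ + ((∫ s in (-T)..T, a s) + B * (Real.exp (K * |t|) - 1)) := by gcongr; linarith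
      _ = B * Real.exp (K * |t|) := by rw [hB]; ring

lemma exists_norm_picardIter_le (hF : IsCaratheodoryField F a K) (x₀ : E) (T : ℝ) :
    ∃ R, ∀ n t, |t| ≤ T → ‖picardIter F x₀ n t‖ ≤ R := by
  refine ⟨(‖x₀‖ + ∫ s in (-T)..T, a s) * Real.exp (K * T), fun n t ht => ?_⟩
  refine (hF.norm_picardIter_le x₀ n ht).trans ?_
  have hT : -T ≤ T := by linarith [abs_nonneg t]
  have hA : 0 ≤ ∫ s in (-T)..T, a s := intervalIntegral.integral_nonneg hT fun s _ => hF.nonneg s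
  have := hF.growth_nonneg
  gcongr

lemma exists_norm_picardIter_sub_le (hF : IsCaratheodoryField F a K) (x₀ : E) (T : ℝ) :
    ∃ D c : ℝ, ∀ n t, |t| ≤ T →
      ‖picardIter F x₀ n t - picardIter F x₀ (n + 1) t‖ ≤ D * (1 / 2) ^ n * Real.exp (c * |t|) := by
  obtain ⟨R, hR⟩ := hF.exists_norm_picardIter_le x₀ T
  obtain ⟨L, hL0, hL⟩ := hF.lipschitz R
  obtain ⟨c, hc0, hc⟩ := exists_exp_weight hF.memL2Loc L T
  -- Two iterates in the ball of radius `R` differ by at most `2R`; each further step gains the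
  -- factor 1/2 from the weight `exp (c|t|)`.
  refine ⟨2 * R, c, fun n => ?_⟩
  induction n with
  | zero =>
    intro t ht
    have hR0 : 0 ≤ R := (norm_nonneg _).trans (hR 0 t ht)
    have h1 : ‖picardIter F x₀ 0 t - picardIter F x₀ (0 + 1) t‖ ≤ 2 * R :=
      (norm_sub_le _ _).trans (by linarith [hR 0 t ht, hR (0 + 1) t ht])
    have h2 : 1 ≤ Real.exp (c * |t|) := Real.one_le_exp (by positivity)
    simpa using h1.trans (le_mul_of_one_le_right (by positivity) h2)
  | succ n ih =>
    intro t ht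
    have hR0 : 0 ≤ R := (norm_nonneg _).trans (hR 0 t ht)
    have hcont := hF.continuous_picardIter x₀
    have heq : picardIter F x₀ (n + 1) t - picardIter F x₀ (n + 1 + 1) t
        = ∫ s in (0 : ℝ)..t, (F s (picardIter F x₀ n s) - F s (picardIter F x₀ (n + 1) s)) := by
      rw [intervalIntegral.integral_sub (hF.intervalIntegrable_comp (hcont _) _ _)
        (hF.intervalIntegrable_comp (hcont _) _ _)]
      simp [picardIter]
    have hint : IntervalIntegrable (fun s => L * a s * Real.exp (c * |s|)) volume 0 t := by
      refine IntervalIntegrable.mul_continuousOn (IntervalIntegrable.const_mul ?_ L)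
        (by fun_prop : Continuous fun s : ℝ => Real.exp (c * |s|)).continuousOn
      exact (hF.memL2Loc.locallyIntegrable.integrableOn_isCompact isCompact_uIcc).intervalIntegrable
    rw [heq]
    calc ‖∫ s in (0 : ℝ)..t, (F s (picardIter F x₀ n s) - F s (picardIter F x₀ (n + 1) s))‖
        ≤ |∫ s in (0 : ℝ)..t, 2 * R * (1 / 2) ^ n * (L * a s * Real.exp (c * |s|))| := by
          refine intervalIntegral.norm_integral_le_abs_of_norm_le ?_ (hint.const_mul _)
          refine (ae_restrict_iff' measurableSet_uIoc).2 (ae_of_all _ fun s hs => ?_)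
          have hs' : |s| ≤ |t| := by simpa using abs_sub_left_of_mem_uIcc (uIoc_subset_uIcc hs)
          have hsT := hs'.trans ht
          have hLa : 0 ≤ L * a s := mul_nonneg hL0 (hF.nonneg s)
          calc _ ≤ L * a s * ‖picardIter F x₀ n s - picardIter F x₀ (n + 1) s‖ :=
                hL s _ _ (hR _ _ hsT) (hR _ _ hsT)
            _ ≤ L * a s * (2 * R * (1 / 2) ^ n * Real.exp (c * |s|)) := by
                gcongr; exact ih s hsT
            _ = _ := by ring
      _ = 2 * R * (1 / 2) ^ n * |∫ s in (0 : ℝ)..t, L * a s * Real.exp (c * |s|)| := by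
          rw [intervalIntegral.integral_const_mul, abs_mul, abs_of_nonneg (by positivity)]
      _ ≤ 2 * R * (1 / 2) ^ n * (1 / 2 * Real.exp (c * |t|)) := by gcongr; exact hc t ht
      _ = 2 * R * (1 / 2) ^ (n + 1) * Real.exp (c * |t|) := by ring

variable [CompleteSpace E]

lemma tendsto_picardIter (hF : IsCaratheodoryField F a K) (x₀ : E) (t : ℝ) :
    Tendsto (fun n => picardIter F x₀ n t) atTop (𝓝 (picardLimit F x₀ t)) := by
  obtain ⟨D, c, h⟩ := hF.exists_norm_picardIter_sub_le x₀ |t|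
  have hc : CauchySeq fun n => picardIter F x₀ n t := by
    refine cauchySeq_of_le_geometric (1 / 2) (D * Real.exp (c * |t|)) (by norm_num) fun n => ?_
    rw [dist_eq_norm]
    refine (h n t le_rfl).trans (le_of_eq (by ring))
  exact hc.tendsto_limUnder

lemma exists_norm_picardLimit_le (hF : IsCaratheodoryField F a K) (x₀ : E) (T : ℝ) :
    ∃ R, (∀ n t, |t| ≤ T → ‖picardIter F x₀ n t‖ ≤ R) ∧
      ∀ t, |t| ≤ T → ‖picardLimit F x₀ t‖ ≤ R := by
  obtain ⟨R, hR⟩ := hF.exists_norm_picardIter_le x₀ T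
  exact ⟨R, hR, fun t ht => le_of_tendsto (hF.tendsto_picardIter x₀ t).norm
    (Eventually.of_forall fun n => hR n t ht)⟩

lemma picardLimit_eq (hF : IsCaratheodoryField F a K) (x₀ : E) (t : ℝ) :
    IntervalIntegrable (fun s => F s (picardLimit F x₀ s)) volume 0 t ∧
    picardLimit F x₀ t = x₀ + ∫ s in (0 : ℝ)..t, F s (picardLimit F x₀ s) := by
  obtain ⟨R, hR, hR'⟩ := hF.exists_norm_picardLimit_le x₀ |t|
  obtain ⟨L, hL0, hL⟩ := hF.lipschitz R
  have hcont := hF.continuous_picardIter x₀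
  have hlim : ∀ s, |s| ≤ |t| → Tendsto (fun n => F s (picardIter F x₀ n s)) atTop
      (𝓝 (F s (picardLimit F x₀ s))) := by
    intro s hs
    rw [tendsto_iff_norm_sub_tendsto_zero]
    have h0 : Tendsto (fun n => L * a s * ‖picardIter F x₀ n s - picardLimit F x₀ s‖) atTop
        (𝓝 (L * a s * 0)) :=
      (tendsto_iff_norm_sub_tendsto_zero.1 (hF.tendsto_picardIter x₀ s)).const_mul _
    rw [mul_zero] at h0
    exact squeeze_zero (fun n => norm_nonneg _) (fun n => hL s _ _ (hR n s hs) (hR' s hs)) h0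
  have hmem : ∀ s ∈ uIoc 0 t, |s| ≤ |t| := fun s hs => by
    simpa using abs_sub_left_of_mem_uIcc (uIoc_subset_uIcc hs)
  have hbi : IntervalIntegrable (fun s => a s + K * R) volume 0 t :=
    ((hF.memL2Loc.locallyIntegrable.integrableOn_isCompact isCompact_uIcc).intervalIntegrable).add
      intervalIntegrable_const
  have hK := hF.growth_nonneg
  -- The limit is not yet known to be continuous, so measurability comes from that of the iterates.
  have hmeas : AEStronglyMeasurable (fun s => F s (picardLimit F x₀ s))
      (volume.restrict (uIoc 0 t)) :=
    aestronglyMeasurable_of_tendsto_ae atTop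
      (fun n => (hF.aestronglyMeasurable _ (hcont n)).restrict)
      ((ae_restrict_iff' measurableSet_uIoc).2 (ae_of_all _ fun s hs => hlim s (hmem s hs)))
  refine ⟨hbi.mono_fun' hmeas ((ae_restrict_iff' measurableSet_uIoc).2 (ae_of_all _ fun s hs => ?_)),
    ?_⟩
  · exact (hF.growth s _).trans (by have := hR' s (hmem s hs); dsimp only; gcongr)
  · have h1 : Tendsto (fun n => picardIter F x₀ (n + 1) t) atTop
        (𝓝 (x₀ + ∫ s in (0 : ℝ)..t, F s (picardLimit F x₀ s))) := by
      refine tendsto_const_nhds.add ?_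
      refine intervalIntegral.tendsto_integral_filter_of_dominated_convergence
        (fun s => a s + K * R) ?_ ?_ hbi ?_
      · exact Eventually.of_forall fun n => (hF.aestronglyMeasurable _ (hcont n)).restrict
      · refine Eventually.of_forall fun n => ae_of_all _ fun s hs => (hF.growth s _).trans ?_
        gcongr
        exact hR n s (hmem s hs)
      · exact ae_of_all _ fun s hs => hlim s (hmem s hs)
    exact tendsto_nhds_unique ((tendsto_add_atTop_iff_nat 1).2 (hF.tendsto_picardIter x₀ t)) h1

lemma continuous_picardLimit (hF : IsCaratheodoryField F a K) (x₀ : E) :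
    Continuous (picardLimit F x₀) := by
  have h : picardLimit F x₀ = fun t => x₀ + ∫ s in (0 : ℝ)..t, F s (picardLimit F x₀ s) :=
    funext fun t => (hF.picardLimit_eq x₀ t).2
  rw [h]
  exact continuous_const.add (intervalIntegral.continuous_primitive
    (fun s t => (hF.picardLimit_eq x₀ s).1.symm.trans (hF.picardLimit_eq x₀ t).1) 0)

end IsCaratheodoryField

/-- Integration by parts by Fubini on `{s ≤ t}`, since `v` is only locally integrable. -/
lemma integral_deriv_smul_primitive [CompleteSpace E] {v : ℝ → E}
    (hv : LocallyIntegrable v volume) (x₀ : E) {φ : ℝ → ℝ} (hφ : ContDiff ℝ 1 φ)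
    (hφc : HasCompactSupport φ) :
    ∫ t, deriv φ t • (x₀ + ∫ s in (0 : ℝ)..t, v s) = -∫ t, φ t • v t := by
  have hφ' : Continuous (deriv φ) := hφ.continuous_deriv le_rfl
  have hφ'c : HasCompactSupport (deriv φ) := hφc.deriv
  obtain ⟨T, hT0, hT⟩ : ∃ T : ℝ, 0 < T ∧ tsupport φ ⊆ Ioo (-T) T := by
    obtain ⟨T, hT⟩ := hφc.isCompact.isBounded.subset_ball (0 : ℝ)
    refine ⟨max T 1, by positivity, hT.trans ?_⟩
    rw [Real.ball_eq_Ioo]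
    exact Ioo_subset_Ioo (by simp) (by simp)
  have hii : ∀ a b, IntervalIntegrable v volume a b := fun a b =>
    (hv.integrableOn_isCompact isCompact_uIcc).intervalIntegrable
  -- Cutting off outside the support of `φ` makes `v` integrable. The primitive changes there only
  -- by a constant, which `∫ φ' = 0` removes.
  set w : ℝ → E := (Ioc (-T) T).indicator v with hw
  have hwi : Integrable w := ((hv.integrableOn_isCompact isCompact_Icc).mono_set
    Ioc_subset_Icc_self).integrable_indicator measurableSet_Ioc
  have hprim : ∀ t, deriv φ t • (x₀ + ∫ s in (0 : ℝ)..t, v s)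
      = deriv φ t • (x₀ + ∫ s in (0 : ℝ)..(-T), v s) + deriv φ t • ∫ s in Iic t, w s := by
    intro t
    by_cases ht : t ∈ tsupport φ
    · have ht' := hT ht
      rw [← smul_add, add_assoc]
      congr 2
      rw [← intervalIntegral.integral_add_adjacent_intervals (hii 0 (-T)) (hii (-T) t)]
      congr 1
      rw [intervalIntegral.integral_of_le ht'.1.le, hw, setIntegral_indicator measurableSet_Ioc,
        Iic_inter_Ioc_of_le ht'.2.le]
    · have : deriv φ t = 0 := by
        by_contra h
        exact ht (support_deriv_subset h)
      simp [this]
  have hcont : Continuous fun t => ∫ s in Iic t, w s := by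
    have h1 : (fun t => ∫ s in Iic t, w s) =
        fun t => (∫ s in Iic 0, w s) + ∫ s in (0 : ℝ)..t, w s := by
      funext t
      rw [intervalIntegral.integral_Iic_sub_Iic hwi.integrableOn hwi.integrableOn |>.symm]
      abel
    rw [h1]
    exact continuous_const.add (intervalIntegral.continuous_primitive
      (fun a b => hwi.intervalIntegrable) 0)
  simp_rw [hprim]
  rw [integral_add, integral_smul_const, integral_eq_zero_of_hasDerivAt_of_integrable
    (f := φ) (f' := deriv φ)]
  rotate_left
  · exact fun t => (hφ.differentiable one_ne_zero t).hasDerivAt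
  · exact hφ'.integrable_of_hasCompactSupport hφ'c
  · exact hφ.continuous.integrable_of_hasCompactSupport hφc
  · exact (hφ'.smul continuous_const).integrable_of_hasCompactSupport hφ'c.smul_right
  · exact (hφ'.smul hcont).integrable_of_hasCompactSupport hφ'c.smul_right
  rw [zero_smul, zero_add]
  calc ∫ t, deriv φ t • ∫ s in Iic t, w s
      = ∫ t, ∫ s, {p : ℝ × ℝ | p.2 ≤ p.1}.indicator (fun p => deriv φ p.1 • w p.2) (t, s) := by
        congr with t
        rw [← integral_smul, ← integral_indicator measurableSet_Iic]
        rfl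
    _ = ∫ s, ∫ t, {p : ℝ × ℝ | p.2 ≤ p.1}.indicator (fun p => deriv φ p.1 • w p.2) (t, s) := by
        refine integral_integral_swap
          (f := fun t s => {p : ℝ × ℝ | p.2 ≤ p.1}.indicator (fun p => deriv φ p.1 • w p.2) (t, s)) ?_
        refine Integrable.indicator ?_ (measurableSet_le measurable_snd measurable_fst)
        exact (hφ'.integrable_of_hasCompactSupport hφ'c).smul_prod hwi
    _ = ∫ s, -(φ s • v s) := by
        congr with s
        have h1 : ∀ t, {p : ℝ × ℝ | p.2 ≤ p.1}.indicator (fun p => deriv φ p.1 • w p.2) (t, s)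
            = (Ici s).indicator (fun t => deriv φ t • w s) t := fun t => rfl
        simp_rw [h1]
        rw [integral_indicator measurableSet_Ici, integral_Ici_eq_integral_Ioi,
          integral_smul_const, hφc.integral_Ioi_deriv_eq hφ, neg_smul]
        by_cases hs : s ∈ tsupport φ
        · rw [hw, indicator_of_mem (Ioo_subset_Ioc_self (hT hs))]
        · rw [image_eq_zero_of_notMem_tsupport hs]
          simp
    _ = -∫ t, φ t • v t := integral_neg _

end Caratheodory

/-! ### Gaussian measures: image measures, invariance under the free evolution, second moments. -/

section Gaussian

open Filter Topology Set

/-- Almost-everywhere statements pass to image measures without any measurability of the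
predicate, since Borel images in Polish spaces are inner approximated by compact sets. -/
lemma ae_map_of_ae_comp {X Y : Type*} [tX : TopologicalSpace X] [hX : PolishSpace X]
    [mX : MeasurableSpace X]
    [BorelSpace X] [TopologicalSpace Y] [T2Space Y] [SecondCountableTopology Y]
    [MeasurableSpace Y] [BorelSpace Y] {μ : Measure X} [IsFiniteMeasure μ] {f : X → Y}
    (hf : AEMeasurable f μ) {p : Y → Prop} (h : ∀ᵐ x ∂μ, p (f x)) : ∀ᵐ y ∂(μ.map f), p y := by
  obtain ⟨g, hg, hfg⟩ := hf
  rw [Measure.map_congr hfg]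
  have h' : ∀ᵐ x ∂μ, p (g x) := by
    filter_upwards [h, hfg] with x hx hxg
    rwa [← hxg]
  obtain ⟨A, hAsub, hA, hAμ⟩ := exists_measurable_superset_of_null (ae_iff.1 h')
  have hborel : mX = @borel X tX := BorelSpace.measurable_eq
  -- A finer Polish topology with the same Borel sets makes `g` continuous, so images of compact
  -- sets are compact and hence measurable.
  obtain ⟨t', ht', hcont, hpol⟩ := hg.exists_continuous
  have hbor : @BorelSpace X t' _ := by
    refine @BorelSpace.mk X t' _ ?_
    exact hborel.trans (@borel_eq_borel_of_le X t' tX hpol hX ht').symm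
  have hreg := @innerRegular_isCompact_isClosed_measurableSet_of_finite X _ t' _ _ hbor μ _
  rw [ae_iff, ← nonpos_iff_eq_zero]
  refine ENNReal.le_of_forall_pos_le_add fun ε hε _ => ?_
  have hAc : MeasurableSet Aᶜ := hA.compl
  obtain ⟨K, hKA, ⟨hKc, hKcl⟩, hK⟩ : ∃ K ⊆ Aᶜ, (@IsCompact X t' K ∧ @IsClosed X t' K) ∧
      μ Aᶜ ≤ μ K + ε := by
    rcases eq_or_ne (μ Aᶜ) 0 with h0 | h0
    · refine ⟨∅, empty_subset _, ⟨@isCompact_empty X t', @isClosed_empty X t'⟩, ?_⟩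
      simp [h0]
    · obtain ⟨K, hKA, hK, hlt⟩ := hreg hAc (μ Aᶜ - ε)
        (ENNReal.sub_lt_self (measure_ne_top _ _) h0 (by simpa using hε.ne'))
      exact ⟨K, hKA, hK, tsub_le_iff_right.1 hlt.le⟩
  have hKm : MeasurableSet K := hKcl.measurableSet
  have himg : IsCompact (g '' K) := hKc.image hcont
  calc μ.map g {y | ¬ p y} ≤ μ.map g (g '' K)ᶜ := by
        refine measure_mono fun y hy => ?_
        rintro ⟨x, hx, rfl⟩
        exact hKA hx (hAsub hy)
    _ = μ (g ⁻¹' (g '' K)ᶜ) := Measure.map_apply hg himg.isClosed.measurableSet.compl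
    _ ≤ μ Kᶜ := measure_mono fun x hx hxK => hx (mem_image_of_mem g hxK)
    _ ≤ 0 + ε := by
        have h1 : Kᶜ ⊆ A ∪ (Aᶜ \ K) := fun x hx => by
          by_cases hxA : x ∈ A
          · exact Or.inl hxA
          · exact Or.inr ⟨hxA, hx⟩
        refine (measure_mono h1).trans ((measure_union_le _ _).trans (add_le_add hAμ.le ?_))
        rw [measure_sdiff hKA hKm.nullMeasurableSet (measure_ne_top _ _)]
        exact tsub_le_iff_left.2 hK

variable {X : Type*} [NormedAddCommGroup X] [InnerProductSpace ℝ X] [CompleteSpace X]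
  [MeasurableSpace X] {γ : Measure X} {K : X →L[ℝ] X}

lemma IsCenteredGaussian.map_dual (hγ : IsCenteredGaussian γ K) (L : X →L[ℝ] ℝ) :
    ∃ v : ℝ≥0, γ.map L = gaussianReal 0 v := by
  refine ⟨_, Eq.trans ?_ (hγ ((InnerProductSpace.toDual ℝ X).symm L))⟩
  simp

variable [BorelSpace X]

lemma IsCenteredGaussian.isGaussian (hγ : IsCenteredGaussian γ K) : IsGaussian γ :=
  isGaussian_of_map_eq_gaussianReal fun L => ⟨0, hγ.map_dual L⟩

lemma IsCenteredGaussian.integral_dual (hγ : IsCenteredGaussian γ K) (L : X →L[ℝ] ℝ) :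
    γ[L] = 0 := by
  obtain ⟨v, hv⟩ := hγ.map_dual L
  have := integral_map (μ := γ) (φ := L) (by fun_prop) (f := fun x : ℝ => x) (by fun_prop)
  rw [hv, integral_id_gaussianReal] at this
  exact this.symm

lemma IsCenteredGaussian.map_clm (hγ : IsCenteredGaussian γ K) (T : X →L[ℝ] X) :
    IsCenteredGaussian (γ.map T) (T.comp (K.comp T.adjoint)) := by
  intro x
  rw [Measure.map_map (by fun_prop) (by fun_prop)]
  have h1 : (fun η => ⟪x, η⟫_ℝ) ∘ T = fun η => ⟪T.adjoint x, η⟫_ℝ := by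
    ext η
    simp [ContinuousLinearMap.adjoint_inner_left]
  rw [h1, hγ]
  simp [ContinuousLinearMap.adjoint_inner_right]

variable [SecondCountableTopology X]

lemma IsCenteredGaussian.eq {γ' : Measure X} (hγ : IsCenteredGaussian γ K)
    (hγ' : IsCenteredGaussian γ' K) : γ = γ' := by
  have := hγ.isGaussian
  have := hγ'.isGaussian
  refine Measure.ext_of_charFunDual ?_
  ext L
  have h : γ.map L = γ'.map L := by
    have h1 := hγ ((InnerProductSpace.toDual ℝ X).symm L)
    have h2 := hγ' ((InnerProductSpace.toDual ℝ X).symm L)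
    simpa using h1.trans h2.symm
  rw [charFunDual_eq_charFun_map_one, charFunDual_eq_charFun_map_one, h]

/-- The image covariance is `T ι ι* T* = ι S S* ι* = ι ι*` up to the factor `c`, and the covariance
determines a centered Gaussian measure. -/
lemma IsCenteredGaussian.measurePreserving {H : Type*} [NormedAddCommGroup H]
    [InnerProductSpace ℝ H] [CompleteSpace H] {c : ℝ} {ι : H →L[ℝ] X}
    (hγ : IsCenteredGaussian γ (c • ι.comp ι.adjoint)) {S : H →L[ℝ] H}
    (hS : S ∈ unitary (H →L[ℝ] H)) {T : X →L[ℝ] X} (hT : ∀ h, T (ι h) = ι (S h)) :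
    MeasurePreserving T γ γ := by
  refine ⟨by fun_prop, IsCenteredGaussian.eq (K := c • ι.comp ι.adjoint) ?_ hγ⟩
  convert hγ.map_clm T using 1
  have h1 : T.comp ι = ι.comp S := by ext h; exact hT h
  have h2 : ι.adjoint.comp T.adjoint = S.adjoint.comp ι.adjoint := by
    rw [← ContinuousLinearMap.adjoint_comp, h1, ContinuousLinearMap.adjoint_comp]
  have h3 : ∀ x, S (S.adjoint x) = x := fun x => by
    have := (Unitary.mem_iff.1 hS).2
    exact congrArg (fun A : H →L[ℝ] H => A x) this
  ext x
  have h2x : ι.adjoint (T.adjoint x) = S.adjoint (ι.adjoint x) :=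
    congrArg (fun A : X →L[ℝ] H => A x) h2
  simp [h2x, hT, h3]

/-- Fernique: measurable linear maps on a Gaussian space have second moments. -/
lemma IsMeasurableLinearExtension.memLp_two {H Y : Type*} [NormedAddCommGroup H]
    [InnerProductSpace ℝ H] [NormedAddCommGroup Y] [NormedSpace ℝ Y] [SecondCountableTopology Y]
    [MeasurableSpace Y] [BorelSpace Y] {ι : H →L[ℝ] X} {f : H → Y} {fhat : X → Y}
    (hf : IsMeasurableLinearExtension γ ι f fhat) (hγ : IsCenteredGaussian γ K)
    (hfm : AEMeasurable fhat γ) : MemLp fhat 2 γ := by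
  have hG := hγ.isGaussian
  have hrot := IsGaussian.map_rotation_eq_self_of_forall_strongDual_eq_zero hγ.integral_dual
    (-(Real.pi / 4))
  obtain ⟨V, -, hVγ, hadd, hsmul⟩ := hf.linear
  have hprob : IsProbabilityMeasure (γ.map fhat) := Measure.isProbabilityMeasure_map hfm
  obtain ⟨g, hg, hfg⟩ := id hfm
  have hfgprod : Prod.map fhat fhat =ᵐ[γ.prod γ] Prod.map g g := by
    filter_upwards [Measure.quasiMeasurePreserving_fst.ae hfg,
      Measure.quasiMeasurePreserving_snd.ae hfg] with p h1 h2
    exact Prod.ext h1 h2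
  have hprod : AEMeasurable (Prod.map fhat fhat) (γ.prod γ) := ⟨_, hg.prodMap hg, hfgprod⟩
  have hprodmap : (γ.map fhat).prod (γ.map fhat) = (γ.prod γ).map (Prod.map fhat fhat) := by
    rw [Measure.map_congr hfg, Measure.map_congr hfgprod, Measure.map_prod_map _ _ hg hg]
  -- Almost surely `fhat` acts linearly, so it commutes with the rotation. The law of `fhat` thus
  -- inherits rotation invariance, which is all that Fernique's theorem requires.
  have hrot' : ((γ.map fhat).prod (γ.map fhat)).map (ContinuousLinearMap.rotation (-(Real.pi / 4)))
      = (γ.map fhat).prod (γ.map fhat) := by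
    have hprod' : AEMeasurable (Prod.map fhat fhat)
        ((γ.prod γ).map (ContinuousLinearMap.rotation (-(Real.pi / 4)))) := by rwa [hrot]
    rw [hprodmap, AEMeasurable.map_map_of_aemeasurable (by fun_prop) hprod]
    conv_rhs => rw [← hrot, AEMeasurable.map_map_of_aemeasurable hprod' (by fun_prop)]
    refine Measure.map_congr ?_
    have hV1 : ∀ᵐ p ∂γ.prod γ, p.1 ∈ V := Measure.quasiMeasurePreserving_fst.ae hVγ
    have hV2 : ∀ᵐ p ∂γ.prod γ, p.2 ∈ V := Measure.quasiMeasurePreserving_snd.ae hVγ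
    filter_upwards [hV1, hV2] with p h1 h2
    simp only [Function.comp_apply, ContinuousLinearMap.rotation_apply, Prod.map_apply]
    rw [hadd _ (V.smul_mem _ h1) _ (V.smul_mem _ h2), hadd _ (V.smul_mem _ h1) _ (V.smul_mem _ h2),
      hsmul _ _ h1, hsmul _ _ h1, hsmul _ _ h2, hsmul _ _ h2]
    rfl
  obtain ⟨C, hC, hint⟩ := exists_integrable_exp_sq_of_map_rotation_eq_self hrot'
  have hid : MemLp id 2 (γ.map fhat) := by
    rw [memLp_two_iff_integrable_sq_norm (by fun_prop)]
    refine (hint.const_mul C⁻¹).mono' (by fun_prop) (ae_of_all _ fun y => ?_)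
    have h1 := Real.add_one_le_exp (C * ‖y‖ ^ 2)
    rw [Real.norm_of_nonneg (by positivity), id, inv_mul_eq_div, le_div_iff₀ hC]
    linarith
  exact (memLp_map_measure_iff (by fun_prop) hfm).1 hid

end Gaussian

/-! ### System A and the bath response under a prescribed force. -/

section System

open Filter Topology Set

variable {Z H : Type*}
  [NormedAddCommGroup Z] [InnerProductSpace ℝ Z] [CompleteSpace Z]
  [NormedAddCommGroup H] [InnerProductSpace ℝ H] [CompleteSpace H]

namespace IsUnitaryGroupGeneratedBy

variable {JB : H →ₗ.[ℝ] H} {S : ℝ → H →L[ℝ] H}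

lemma norm_apply (hS : IsUnitaryGroupGeneratedBy S JB) (t : ℝ) (h : H) : ‖S t h‖ = ‖h‖ :=
  ContinuousLinearMap.norm_map_of_mem_unitary (hS.unitary t) h

lemma continuous_uncurry (hS : IsUnitaryGroupGeneratedBy S JB) :
    Continuous fun p : ℝ × H => S p.1 p.2 := by
  refine continuous_prod_of_continuous_lipschitzWith' (fun p : ℝ × H => S p.1 p.2) 1 (fun t => ?_)
    hS.group.continuous
  refine LipschitzWith.of_dist_le_mul fun x y => ?_
  rw [dist_eq_norm, dist_eq_norm, ← map_sub, hS.norm_apply]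
  simp

lemma comp_neg (hS : IsUnitaryGroupGeneratedBy S JB) (s t : ℝ) (h : H) :
    S s (S (-t) h) = S (s - t) h := by
  rw [sub_eq_add_neg, hS.group.add]
  rfl

end IsUnitaryGroupGeneratedBy

/-- The velocity of system A in the state `(z, S t u - C z)`, under the external force `p`. -/
noncomputable def interactionVelocity (HA : Z → ℝ) (JA : Z → Z →L[ℝ] Z) (C : Z →L[ℝ] H)
    (S : ℝ → H →L[ℝ] H) (t : ℝ) (x : Z × H) (p : Z) : Z :=
  JA x.1 (gradient HA x.1 + C.adjoint (S t x.2 - C x.1) + p)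

/-- The coupled system in the interaction picture `u = S (-t) (y + C z)`, driven by `f`. -/
noncomputable def interactionField (HA : Z → ℝ) (JA : Z → Z →L[ℝ] Z) (C : Z →L[ℝ] H)
    (S : ℝ → H →L[ℝ] H) (f : ℝ → Z) (t : ℝ) (x : Z × H) : Z × H :=
  (interactionVelocity HA JA C S t x (f t), S (-t) (C (interactionVelocity HA JA C S t x (f t))))

/-- The position of system A driven by `f`. -/
noncomputable def drivenPosition (HA : Z → ℝ) (JA : Z → Z →L[ℝ] Z) (C : Z →L[ℝ] H)
    (S : ℝ → H →L[ℝ] H) (z₀ : Z) (f : ℝ → Z) (t : ℝ) : Z :=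
  -- The response vanishes at time 0, hence `u` starts at `C z₀`.
  (picardLimit (interactionField HA JA C S f) (z₀, C z₀) t).1

/-- The response of the heat bath to system A driven by `f`. -/
noncomputable def bathResponse (HA : Z → ℝ) (JA : Z → Z →L[ℝ] Z) (C : Z →L[ℝ] H)
    (S : ℝ → H →L[ℝ] H) (z₀ : Z) (f : ℝ → Z) (t : ℝ) : H :=
  S t (picardLimit (interactionField HA JA C S f) (z₀, C z₀) t).2
    - C (picardLimit (interactionField HA JA C S f) (z₀, C z₀) t).1

variable {HA : Z → ℝ} {JA : Z → Z →L[ℝ] Z} {C : Z →L[ℝ] H} {JB : H →ₗ.[ℝ] H} {S : ℝ → H →L[ℝ] H}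

/-- The force value is a free variable here, so one statement gives measurability along curves and
joint measurability in time, bath state and position. -/
lemma continuous_interactionField (hgrad : Continuous (gradient HA)) (hJA : Continuous JA)
    (hS : IsUnitaryGroupGeneratedBy S JB) :
    Continuous fun q : ℝ × (Z × H) × Z =>
      interactionField HA JA C S (fun _ => q.2.2) q.1 q.2.1 := by
  have hSc := hS.continuous_uncurry
  have h1 : Continuous fun q : ℝ × (Z × H) × Z => S q.1 q.2.1.2 :=
    hSc.comp (by fun_prop : Continuous fun q : ℝ × (Z × H) × Z => (q.1, q.2.1.2))
  have h2 : Continuous fun q : ℝ × (Z × H) × Z =>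
      interactionVelocity HA JA C S q.1 q.2.1 q.2.2 := by
    unfold interactionVelocity
    refine (hJA.comp (by fun_prop)).clm_apply ?_
    fun_prop
  exact h2.prodMk (hSc.comp ((by fun_prop : Continuous fun q : ℝ × (Z × H) × Z => -q.1).prodMk
    (C.continuous.comp h2)))

/-- Linear growth comes from the bound on `JA` and the global Lipschitz bound on the gradient.
Varying `JA` multiplies the force, so the Lipschitz constant in space also grows with `‖f t‖` and is
only `L²_loc` in time. Compactness of balls in `Z` turns the local Lipschitz property of `JA` into a
uniform one; `u` enters affinely. -/
lemma exists_isCaratheodoryField [FiniteDimensional ℝ Z]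
    (hgrad : ∃ K : ℝ≥0, LipschitzWith K (gradient HA))
    (hJA_lip : LocallyLipschitz JA) (hJA_bdd : ∃ M : ℝ, ∀ z, ‖JA z‖ ≤ M)
    (hS : IsUnitaryGroupGeneratedBy S JB) {f : ℝ → Z} (hf : MemL2Loc f) :
    ∃ a K, IsCaratheodoryField (interactionField HA JA C S f) a K := by
  obtain ⟨Kg, hKg⟩ := hgrad
  obtain ⟨M₀, hM₀⟩ := hJA_bdd
  obtain ⟨M, hM0, hM⟩ : ∃ M : ℝ, 1 ≤ M ∧ ∀ z, ‖JA z‖ ≤ M :=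
    ⟨max M₀ 1, le_max_right _ _, fun z => (hM₀ z).trans (le_max_left _ _)⟩
  set c := ‖C‖ with hc
  have hc0 : 0 ≤ c := norm_nonneg _
  set G := ‖gradient HA 0‖ with hG
  have hG0 : 0 ≤ G := norm_nonneg _
  set κ : ℝ := Kg + c * (1 + c) with hκ
  have hκ0 : 0 ≤ κ := by positivity
  set b : ℝ → Z × H → Z → Z := fun t x p =>
    gradient HA x.1 + C.adjoint (S t x.2 - C x.1) + p with hb
  have hb_sub : ∀ t x y p, ‖b t x p - b t y p‖ ≤ κ * ‖x - y‖ := by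
    intro t x y p
    have h1 : b t x p - b t y p = (gradient HA x.1 - gradient HA y.1)
        + C.adjoint (S t (x.2 - y.2) - C (x.1 - y.1)) := by
      simp only [hb, map_sub]; abel
    have hx1 : ‖x.1 - y.1‖ ≤ ‖x - y‖ := norm_fst_le (x - y)
    have hx2 : ‖x.2 - y.2‖ ≤ ‖x - y‖ := norm_snd_le (x - y)
    have h2 : ‖gradient HA x.1 - gradient HA y.1‖ ≤ Kg * ‖x - y‖ := by
      have := hKg.dist_le_mul x.1 y.1
      rw [dist_eq_norm, dist_eq_norm] at this
      exact this.trans (by gcongr)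
    have h3 : ‖C.adjoint (S t (x.2 - y.2) - C (x.1 - y.1))‖ ≤ c * ((1 + c) * ‖x - y‖) := by
      refine (C.adjoint.le_opNorm _).trans ?_
      rw [LinearIsometryEquiv.norm_map]
      gcongr
      refine (norm_sub_le _ _).trans ?_
      rw [hS.norm_apply, add_mul, one_mul]
      exact add_le_add hx2 ((C.le_opNorm _).trans (by gcongr))
    rw [h1]
    refine (norm_add_le _ _).trans ((add_le_add h2 h3).trans (le_of_eq ?_))
    rw [hκ]; ring
  have hb_norm : ∀ t x p, ‖b t x p‖ ≤ G + ‖p‖ + κ * ‖x‖ := by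
    intro t x p
    have h1 := hb_sub t x 0 p
    have h2 : ‖b t 0 p‖ ≤ G + ‖p‖ := by
      simpa [hb] using norm_add_le (gradient HA 0) p
    calc ‖b t x p‖ = ‖b t 0 p + (b t x p - b t 0 p)‖ := by congr 1; abel
      _ ≤ _ := (norm_add_le _ _).trans (by rw [sub_zero] at h1; linarith)
  have hpair : ∀ t (v : Z), ‖((v, S (-t) (C v)) : Z × H)‖ ≤ (1 + c) * ‖v‖ := by
    intro t v
    rw [Prod.norm_mk, hS.norm_apply]
    have h1 := C.le_opNorm v
    have h2 : 0 ≤ c * ‖v‖ := by positivity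
    have h3 := norm_nonneg v
    refine max_le (by linarith) (by linarith)
  -- The summand 1 and the bound `1 ≤ M` let `a` also dominate the Lipschitz terms that carry no
  -- force or no factor `M`.
  set a : ℝ → ℝ := fun t => (1 + c) * M * (G + 1 + ‖f t‖) with ha
  refine ⟨a, (1 + c) * M * κ, by positivity, ?_, ?_, ?_, ?_⟩
  · intro K hK
    have : IsFiniteMeasure (volume.restrict K) := ⟨by simpa using hK.measure_lt_top⟩
    exact ((memLp_const (G + 1)).add (hf K hK).norm).const_mul _
  · intro x hx
    have hcont := continuous_interactionField (C := C) hKg.continuous hJA_lip.continuous hS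
    exact hcont.comp_aestronglyMeasurable (f := fun t => (t, x t, f t))
      (aestronglyMeasurable_id.prodMk
        (hx.aestronglyMeasurable.prodMk hf.locallyIntegrable.aestronglyMeasurable))
  · intro t x
    calc ‖interactionField HA JA C S f t x‖ ≤ (1 + c) * ‖JA x.1 (b t x (f t))‖ := hpair t _
      _ ≤ (1 + c) * (M * (G + ‖f t‖ + κ * ‖x‖)) := by
          gcongr
          exact ((JA x.1).le_opNorm _).trans
            (mul_le_mul (hM _) (hb_norm _ _ _) (norm_nonneg _) (by positivity))
      _ ≤ a t + (1 + c) * M * κ * ‖x‖ := by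
          have : 0 ≤ (1 + c) * M := by positivity
          simp only [ha]
          nlinarith
  · intro R
    obtain ⟨LJ, hLJ⟩ := (hJA_lip.locallyLipschitzOn (s := Metric.closedBall (0 : Z) R)
      ).exists_lipschitzOnWith_of_compact (isCompact_closedBall 0 R)
    refine ⟨LJ * (1 + κ * |R|) + M * κ, by positivity, fun t x y hx hy => ?_⟩
    have hq : 1 ≤ G + 1 + ‖f t‖ := by linarith [norm_nonneg (f t)]
    have h1 : ‖JA x.1 - JA y.1‖ ≤ LJ * ‖x - y‖ := by
      have h2 := hLJ.dist_le_mul x.1 (by simpa using (norm_fst_le x).trans hx) y.1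
        (by simpa using (norm_fst_le y).trans hy)
      rw [dist_eq_norm, dist_eq_norm] at h2
      exact h2.trans (by gcongr; exact norm_fst_le (x - y))
    have h3 : interactionField HA JA C S f t x - interactionField HA JA C S f t y
        = (JA x.1 (b t x (f t)) - JA y.1 (b t y (f t)),
          S (-t) (C (JA x.1 (b t x (f t)) - JA y.1 (b t y (f t))))) := by
      simp [interactionField, interactionVelocity, hb, map_sub]
    have h4 : ‖JA x.1 (b t x (f t)) - JA y.1 (b t y (f t))‖
        ≤ LJ * ‖x - y‖ * (G + ‖f t‖ + κ * |R|) + M * (κ * ‖x - y‖) := by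
      have h5 : JA x.1 (b t x (f t)) - JA y.1 (b t y (f t))
          = (JA x.1 - JA y.1) (b t x (f t)) + JA y.1 (b t x (f t) - b t y (f t)) := by
        simp [map_sub]
      rw [h5]
      refine (norm_add_le _ _).trans (add_le_add ?_ ?_)
      · refine (ContinuousLinearMap.le_opNorm _ _).trans
          (mul_le_mul h1 ((hb_norm _ _ _).trans ?_) (norm_nonneg _) (by positivity))
        gcongr
        exact hx.trans (le_abs_self R)
      · exact (ContinuousLinearMap.le_opNorm _ _).trans
          (mul_le_mul (hM _) (hb_sub _ _ _ _) (norm_nonneg _) (by positivity))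
    rw [h3]
    refine (hpair t _).trans ?_
    have h6 : LJ * ‖x - y‖ * (G + ‖f t‖ + κ * |R|) + M * (κ * ‖x - y‖)
        ≤ (LJ * (1 + κ * |R|) + M * κ) * (G + 1 + ‖f t‖) * ‖x - y‖ := by
      have h7 : G + ‖f t‖ + κ * |R| ≤ (1 + κ * |R|) * (G + 1 + ‖f t‖) := by
        have : 0 ≤ κ * |R| := by positivity
        nlinarith
      have h8 : M * κ ≤ M * κ * (G + 1 + ‖f t‖) :=
        le_mul_of_one_le_right (by positivity) hq
      calc _ ≤ LJ * ‖x - y‖ * ((1 + κ * |R|) * (G + 1 + ‖f t‖))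
            + M * κ * (G + 1 + ‖f t‖) * ‖x - y‖ := by
              rw [← mul_assoc M]
              gcongr
        _ = _ := by ring
    calc (1 + c) * ‖JA x.1 (b t x (f t)) - JA y.1 (b t y (f t))‖
        ≤ (1 + c) * (1 * ((LJ * (1 + κ * |R|) + M * κ) * (G + 1 + ‖f t‖) * ‖x - y‖)) := by
          rw [one_mul]
          gcongr
          exact h4.trans h6
      _ ≤ (1 + c) * (M * ((LJ * (1 + κ * |R|) + M * κ) * (G + 1 + ‖f t‖) * ‖x - y‖)) := by
          gcongr
      _ = _ := by simp only [ha]; ring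

/-- Mild solutions of the coupled system driven by `f`, with bath response `y`. -/
structure IsDrivenSolution (HA : Z → ℝ) (JA : Z → Z →L[ℝ] Z) (C : Z →L[ℝ] H)
    (S : ℝ → H →L[ℝ] H) (z₀ : Z) (f : ℝ → Z) (z v : ℝ → Z) (y : ℝ → H) : Prop where
  continuous_position : Continuous z
  continuous_response : Continuous y
  memL2Loc_velocity : MemL2Loc v
  velocity_eq : ∀ t, v t = JA (z t) (gradient HA (z t) + C.adjoint (y t) + f t)
  position_eq : ∀ t, z t = z₀ + ∫ s in (0 : ℝ)..t, v s
  response_eq : ∀ t, y t = S t (C z₀) - C (z t) + ∫ s in (0 : ℝ)..t, S (t - s) (C (v s))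

lemma exists_isDrivenSolution [FiniteDimensional ℝ Z]
    (hgrad : ∃ K : ℝ≥0, LipschitzWith K (gradient HA))
    (hJA_lip : LocallyLipschitz JA) (hJA_bdd : ∃ M : ℝ, ∀ z, ‖JA z‖ ≤ M)
    (hS : IsUnitaryGroupGeneratedBy S JB) (z₀ : Z) {f : ℝ → Z} (hf : MemL2Loc f) :
    ∃ v, IsDrivenSolution HA JA C S z₀ f (drivenPosition HA JA C S z₀ f) v
      (bathResponse HA JA C S z₀ f) := by
  obtain ⟨a, K, hF⟩ := exists_isCaratheodoryField (C := C) hgrad hJA_lip hJA_bdd hS hf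
  set F := interactionField HA JA C S f with hFdef
  set x := picardLimit F (z₀, C z₀) with hx
  have hxc : Continuous x := hF.continuous_picardLimit _
  have hxe : ∀ t, x t = (z₀, C z₀) + ∫ s in (0 : ℝ)..t, F s (x s) := fun t =>
    (hF.picardLimit_eq (z₀, C z₀) t).2
  have hxi : ∀ t, IntervalIntegrable (fun s => F s (x s)) volume 0 t := fun t =>
    (hF.picardLimit_eq (z₀, C z₀) t).1
  have hl2 := hF.memL2Loc_comp hxc
  refine ⟨fun t => (F t (x t)).1, ?_, ?_, ?_, ?_, ?_, ?_⟩
  · exact continuous_fst.comp hxc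
  · exact (hS.continuous_uncurry.comp (continuous_id.prodMk (continuous_snd.comp hxc))).sub
      (C.continuous.comp (continuous_fst.comp hxc))
  · exact hl2.of_norm_le (continuous_fst.comp_aestronglyMeasurable
      (hF.aestronglyMeasurable x hxc)) fun t => norm_fst_le _
  · exact fun t => rfl
  · intro t
    have h := congrArg (ContinuousLinearMap.fst ℝ Z H) (hxe t)
    rw [map_add, ← ContinuousLinearMap.intervalIntegral_comp_comm _ (hxi t)] at h
    exact h
  · intro t
    -- Applying `S t` to the equation for `u` turns `S (-s)` into `S (t - s)`: Duhamel's formula.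
    have h := congrArg ((S t).comp (ContinuousLinearMap.snd ℝ Z H)) (hxe t)
    rw [map_add, ← ContinuousLinearMap.intervalIntegral_comp_comm _ (hxi t)] at h
    have h2 : bathResponse HA JA C S z₀ f t = S t (x t).2 - C (x t).1 := rfl
    have h3 : ∀ s, (S t).comp (ContinuousLinearMap.snd ℝ Z H) (F s (x s))
        = S (t - s) (C (F s (x s)).1) :=
      fun s => hS.comp_neg t s _
    have h4 : drivenPosition HA JA C S z₀ f t = (x t).1 := rfl
    simp only [h3] at h
    rw [h2, h4, show S t (x t).2 = _ from h]
    simp only [ContinuousLinearMap.comp_apply, ContinuousLinearMap.coe_snd']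
    abel

namespace IsDrivenSolution

variable {z₀ : Z} {f : ℝ → Z} {z v : ℝ → Z} {y : ℝ → H}

lemma isW12LocWithDeriv (h : IsDrivenSolution HA JA C S z₀ f z v y) : IsW12LocWithDeriv z v where
  continuous := h.continuous_position
  memL2 := h.continuous_position.memL2Loc
  deriv_memL2 := h.memL2Loc_velocity
  weak_deriv φ hφ hφc := by
    simp_rw [h.position_eq]
    exact integral_deriv_smul_primitive h.memL2Loc_velocity.locallyIntegrable z₀
      (hφ.of_le (by exact_mod_cast le_top)) hφc

lemma hasDerivAt (h : IsDrivenSolution HA JA C S z₀ f z v y) (hv : Continuous v) (t : ℝ) :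
    HasDerivAt z (v t) t := by
  have h1 : z = fun t => z₀ + ∫ s in (0 : ℝ)..t, v s := funext h.position_eq
  rw [h1]
  exact (hv.integral_hasStrictDerivAt 0 t).hasDerivAt.const_add _

lemma position_zero (h : IsDrivenSolution HA JA C S z₀ f z v y) : z 0 = z₀ := by
  simp [h.position_eq 0]

lemma response_zero (h : IsDrivenSolution HA JA C S z₀ f z v y)
    (hS : IsUnitaryGroupGeneratedBy S JB) : y 0 = 0 := by
  simp [h.response_eq 0, h.position_zero, hS.group.zero]

lemma isFiniteEnergySolution (h : IsDrivenSolution HA JA C S z₀ f z v y)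
    (hS : IsUnitaryGroupGeneratedBy S JB) (hgrad : Continuous (gradient HA)) (hJA : Continuous JA)
    {η₀ : H} (hf : ∀ t, f t = C.adjoint (S t η₀)) :
    IsFiniteEnergySolution HA JA C S z₀ η₀ z (fun t => S t η₀ + y t) := by
  have hz := h.continuous_position
  have hy := h.continuous_response
  have hη : Continuous fun t => S t η₀ := hS.group.continuous η₀
  have hv : Continuous v := by
    rw [funext h.velocity_eq, funext hf]
    exact (hJA.comp hz).clm_apply (by fun_prop)
  have hd : deriv z = v := funext fun t => (h.hasDerivAt hv t).deriv
  refine ⟨h.position_zero, ?_, ?_, hη.add hy, fun t => ?_, fun t => ?_⟩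
  · simp [h.response_zero hS, hS.group.zero]
  · rw [contDiff_one_iff_deriv]
    exact ⟨fun t => (h.hasDerivAt hv t).differentiableAt, hd ▸ hv⟩
  · rw [hd, h.velocity_eq, hf, map_add C.adjoint, add_assoc, add_comm (C.adjoint (y t))]
  · rw [hd, map_add (S t), h.response_eq t]
    abel

end IsDrivenSolution

end System

/-! ### The flow on `Z × X`: measurability, admissible bath states, solutions. -/

section Flow

open Filter Topology Set

section Measurability

lemma measurable_picardIter {Ω E : Type*} [MeasurableSpace Ω] [NormedAddCommGroup E]
    [NormedSpace ℝ E] [SecondCountableTopology E] [MeasurableSpace E] [BorelSpace E]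
    {F : Ω → ℝ → E → E} (hF : Measurable fun q : (ℝ × Ω) × E => F q.1.2 q.1.1 q.2) (x₀ : E)
    (n : ℕ) :
    Measurable fun p : ℝ × Ω => picardIter (F p.2) x₀ n p.1 := by
  induction n with
  | zero => exact measurable_const
  | succ n ih =>
    have h1 : Measurable fun q : (ℝ × Ω) × ℝ => F q.1.2 q.2 (picardIter (F q.1.2) x₀ n q.2) :=
      hF.comp ((measurable_snd.prodMk (measurable_snd.comp measurable_fst)).prodMk
        (ih.comp (measurable_snd.prodMk (measurable_snd.comp measurable_fst))))
    -- The endpoints of integration depend on the parameter, so the interval integral is treated as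
    -- a difference of integrals over sections of measurable sets.
    have h2 : ∀ A : Set ((ℝ × Ω) × ℝ), MeasurableSet A → Measurable fun p : ℝ × Ω =>
        ∫ s in {s | (p, s) ∈ A}, F p.2 s (picardIter (F p.2) x₀ n s) := by
      intro A hA
      have h3 := (h1.indicator hA).stronglyMeasurable.integral_prod_right' (ν := volume)
      convert h3.measurable using 2 with p
      exact (integral_indicator (measurable_prodMk_left hA)).symm
    simp only [picardIter, intervalIntegral]
    refine measurable_const.add ((h2 {q | q.2 ∈ Ioc 0 q.1.1} ?_).sub
      (h2 {q | q.2 ∈ Ioc q.1.1 0} ?_))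
    · exact (measurableSet_lt measurable_const measurable_snd).inter
        (measurableSet_le measurable_snd (measurable_fst.comp measurable_fst))
    · exact (measurableSet_lt (measurable_fst.comp measurable_fst) measurable_snd).inter
        (measurableSet_le measurable_snd measurable_const)

variable {X : Type*} [MeasurableSpace X] {γ : Measure X} [IsFiniteMeasure γ] {T : ℝ → X → X}

/-- Invariance gives the claim at each fixed time, and Fubini exchanges the quantifiers. Since `p`
need not be measurable, its failure set is first enclosed in a measurable null set. -/
lemma ae_ae_comp_of_measurePreserving (hT : Measurable fun p : ℝ × X => T p.1 p.2)
    (hTγ : ∀ t, MeasurePreserving (T t) γ γ) {p : X → Prop} (hp : ∀ᵐ η ∂γ, p η) :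
    ∀ᵐ η ∂γ, ∀ᵐ t : ℝ, p (T t η) := by
  obtain ⟨A, hAsub, hA, hAγ⟩ := exists_measurable_superset_of_null (ae_iff.1 hp)
  have h1 : ∀ᵐ t : ℝ, ∀ᵐ η ∂γ, T t η ∉ A := ae_of_all _ fun t =>
    (hTγ t).quasiMeasurePreserving.ae (measure_eq_zero_iff_ae_notMem.1 hAγ)
  rw [Measure.ae_ae_comm (p := fun t η => T t η ∉ A) (hT hA.compl)] at h1
  filter_upwards [h1] with η hη
  filter_upwards [hη] with t ht
  by_contra h
  exact ht (hAsub h)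

/-- By Tonelli and invariance, the mean of `∫ ‖G (T t η)‖²` over `[-n, n]` is `2n` times the second
moment of `G`. -/
lemma ae_memL2Loc_comp_of_measurePreserving {E : Type*} [NormedAddCommGroup E]
    [SecondCountableTopology E] [MeasurableSpace E] [BorelSpace E]
    (hT : Measurable fun p : ℝ × X => T p.1 p.2) (hTγ : ∀ t, MeasurePreserving (T t) γ γ)
    {G : X → E} (hG : Measurable G) (hG2 : MemLp G 2 γ) :
    ∀ᵐ η ∂γ, MemL2Loc fun t => G (T t η) := by
  have hGT : Measurable fun p : ℝ × X => ‖G (T p.1 p.2)‖ₑ ^ (2 : ℝ) :=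
    ((hG.comp hT).enorm).pow_const _
  have hfin : ∫⁻ η, ‖G η‖ₑ ^ (2 : ℝ) ∂γ < ⊤ := by
    simpa using (eLpNorm_lt_top_iff_lintegral_rpow_enorm_lt_top (by norm_num) (by norm_num)).1 hG2.2
  have h1 : ∀ n : ℕ, ∀ᵐ η ∂γ,
      ∫⁻ t in Icc (-(n : ℝ)) n, ‖G (T t η)‖ₑ ^ (2 : ℝ) < ⊤ := by
    intro n
    refine ae_lt_top ?_ (ne_of_lt ?_)
    · exact (hGT.comp measurable_swap).lintegral_prod_right'
    · rw [lintegral_lintegral_swap (f := fun η t => ‖G (T t η)‖ₑ ^ (2 : ℝ))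
        (hGT.comp measurable_swap).aemeasurable]
      have h2 : ∀ t, ∫⁻ η, ‖G (T t η)‖ₑ ^ (2 : ℝ) ∂γ = ∫⁻ η, ‖G η‖ₑ ^ (2 : ℝ) ∂γ := fun t =>
        (hTγ t).lintegral_comp (f := fun η => ‖G η‖ₑ ^ (2 : ℝ)) (hG.enorm.pow_const _)
      simp_rw [h2]
      rw [lintegral_const]
      exact ENNReal.mul_lt_top hfin (by simp)
  filter_upwards [ae_all_iff.2 h1] with η hη K hK
  obtain ⟨r, hr⟩ := hK.isBounded.subset_closedBall 0
  obtain ⟨n, hn⟩ := exists_nat_ge r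
  have hKn : K ⊆ Icc (-(n : ℝ)) n := by
    refine hr.trans ?_
    rw [Real.closedBall_eq_Icc]
    exact Icc_subset_Icc (by linarith) (by linarith)
  have hmeas : Measurable fun t => G (T t η) := hG.comp (hT.comp measurable_prodMk_right)
  have h3 : MemLp (fun t => G (T t η)) 2 (volume.restrict (Icc (-(n : ℝ)) n)) := by
    refine ⟨hmeas.aestronglyMeasurable, ?_⟩
    rw [eLpNorm_lt_top_iff_lintegral_rpow_enorm_lt_top (by norm_num) (by norm_num)]
    simpa using hη n
  exact h3.mono_measure (Measure.restrict_mono hKn le_rfl)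

end Measurability

variable {Z H X : Type*}
  [NormedAddCommGroup Z] [InnerProductSpace ℝ Z] [CompleteSpace Z]
  [NormedAddCommGroup H] [InnerProductSpace ℝ H] [CompleteSpace H]
  [NormedAddCommGroup X] [InnerProductSpace ℝ X]

/-- The force exerted on system A by the free evolution of the heat bath state `η`. -/
noncomputable def bathForce {W : Submodule ℝ H} (C : Z →L[ℝ] H) (Shat : ℝ → X →L[ℝ] X)
    (Phat : X → W) (η : X) (t : ℝ) : Z :=
  C.adjoint (Phat (Shat t η) : H)

/-- Heat bath states whose free evolution stays in `V` and exerts a square integrable force. -/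
structure IsAdmissible {W : Submodule ℝ H} (C : Z →L[ℝ] H) (Shat : ℝ → X →L[ℝ] X)
    (Phat : X → W) (V : Submodule ℝ X) (η : X) : Prop where
  memL2Loc : MemL2Loc (bathForce C Shat Phat η)
  ae_mem : ∀ᵐ t, Shat t η ∈ V

open Classical in
/-- The flow of the extended system; inadmissible states do not move. -/
noncomputable def extendedFlow (HA : Z → ℝ) (JA : Z → Z →L[ℝ] Z) (C : Z →L[ℝ] H)
    (S : ℝ → H →L[ℝ] H) (ι : H →L[ℝ] X) (Shat : ℝ → X →L[ℝ] X) {W : Submodule ℝ H} (Phat : X → W)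
    (V : Submodule ℝ X) (t : ℝ) (p : Z × X) : Z × X :=
  if IsAdmissible C Shat Phat V p.2 then
    (drivenPosition HA JA C S p.1 (bathForce C Shat Phat p.2) t,
      Shat t p.2 + ι (bathResponse HA JA C S p.1 (bathForce C Shat Phat p.2) t))
  else p

/-- `C*` annihilates the orthogonal complement of `W`, so extending the projection suffices to
extend `C*`. -/
lemma adjoint_orthogonalProjectionOnto {W : Submodule ℝ H} [FiniteDimensional ℝ W]
    {C : Z →L[ℝ] H} (hC : ∀ z, C z ∈ W) (h : H) :
    C.adjoint (W.orthogonalProjectionOnto h : H) = C.adjoint h := by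
  refine ext_inner_right ℝ fun z => ?_
  rw [C.adjoint_inner_left, C.adjoint_inner_left, ← sub_eq_zero, ← inner_sub_left,
    ← neg_sub, inner_neg_left, neg_eq_zero]
  exact Submodule.inner_left_of_mem_orthogonal (hC z) (W.sub_starProjection_mem_orthogonal h)

variable {HA : Z → ℝ} {JA : Z → Z →L[ℝ] Z} {C : Z →L[ℝ] H} {JB : H →ₗ.[ℝ] H} {S : ℝ → H →L[ℝ] H}
  {ι : H →L[ℝ] X} {Shat : ℝ → X →L[ℝ] X} {W : Submodule ℝ H} {Phat : X → W}
  {V : Submodule ℝ X}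

section Admissible

variable [FiniteDimensional ℝ W]

lemma bathForce_coe (hC : ∀ z, C z ∈ W) (hShat_ext : ∀ t h, Shat t (ι h) = ι (S t h))
    (hext : ∀ h, Phat (ι h) = W.orthogonalProjectionOnto h) (h : H) (t : ℝ) :
    bathForce C Shat Phat (ι h) t = C.adjoint (S t h) := by
  rw [bathForce, hShat_ext, hext, adjoint_orthogonalProjectionOnto hC]

lemma adjoint_extension_add (hC : ∀ z, C z ∈ W)
    (hext : ∀ h, Phat (ι h) = W.orthogonalProjectionOnto h) (hV : ∀ h, ι h ∈ V)
    (hadd : ∀ x ∈ V, ∀ y ∈ V, Phat (x + y) = Phat x + Phat y) {η : X} (hη : η ∈ V) (h : H) :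
    C.adjoint (Phat (η + ι h) : H) = C.adjoint (Phat η : H) + C.adjoint h := by
  rw [hadd _ hη _ (hV h), hext, Submodule.coe_add, map_add, adjoint_orthogonalProjectionOnto hC]

lemma IsAdmissible.bathForce_add {η : X} (hη : IsAdmissible C Shat Phat V η)
    (hC : ∀ z, C z ∈ W) (hShat_ext : ∀ t h, Shat t (ι h) = ι (S t h))
    (hext : ∀ h, Phat (ι h) = W.orthogonalProjectionOnto h) (hV : ∀ h, ι h ∈ V)
    (hadd : ∀ x ∈ V, ∀ y ∈ V, Phat (x + y) = Phat x + Phat y) (h : H) :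
    ∀ᵐ t, bathForce C Shat Phat (η + ι h) t
      = bathForce C Shat Phat η t + C.adjoint (S t h) := by
  filter_upwards [hη.ae_mem] with t ht
  rw [bathForce, map_add, hShat_ext, adjoint_extension_add hC hext hV hadd ht, bathForce]

/-- The shift changes the force by a continuous function. As `h` is arbitrary it may depend on `η`,
as it does for data with prescribed observable part. -/
lemma IsAdmissible.add {η : X} (hη : IsAdmissible C Shat Phat V η)
    (hC : ∀ z, C z ∈ W) (hS : IsUnitaryGroupGeneratedBy S JB)
    (hShat_ext : ∀ t h, Shat t (ι h) = ι (S t h))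
    (hext : ∀ h, Phat (ι h) = W.orthogonalProjectionOnto h) (hV : ∀ h, ι h ∈ V)
    (hadd : ∀ x ∈ V, ∀ y ∈ V, Phat (x + y) = Phat x + Phat y) (h : H) :
    IsAdmissible C Shat Phat V (η + ι h) where
  memL2Loc := by
    have hc : Continuous fun t => C.adjoint (S t h) :=
      C.adjoint.continuous.comp (hS.group.continuous h)
    refine (hη.memL2Loc.add hc.memL2Loc).congr_ae ?_
    filter_upwards [hη.bathForce_add hC hShat_ext hext hV hadd h] with t ht
    exact ht.symm
  ae_mem := by
    filter_upwards [hη.ae_mem] with t ht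
    rw [map_add, hShat_ext]
    exact V.add_mem ht (hV _)

lemma isAdmissible_coe (hC : ∀ z, C z ∈ W) (hS : IsUnitaryGroupGeneratedBy S JB)
    (hShat_ext : ∀ t h, Shat t (ι h) = ι (S t h))
    (hext : ∀ h, Phat (ι h) = W.orthogonalProjectionOnto h) (hV : ∀ h, ι h ∈ V) (h : H) :
    IsAdmissible C Shat Phat V (ι h) where
  memL2Loc := by
    rw [funext (bathForce_coe hC hShat_ext hext h)]
    exact (C.adjoint.continuous.comp (hS.group.continuous h)).memL2Loc
  ae_mem := ae_of_all _ fun t => by rw [hShat_ext]; exact hV _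

/-- Almost every heat bath state is admissible, with force given by a Borel version of `Phat`. -/
lemma exists_measurable_bathForce [MeasurableSpace Z] [BorelSpace Z]
    [SecondCountableTopology H] [MeasurableSpace H] [BorelSpace H] [CompleteSpace X]
    [SecondCountableTopology X] [MeasurableSpace X] [BorelSpace X] {γ : Measure X} {c : ℝ}
    (hγ : IsCenteredGaussian γ (c • ι.comp ι.adjoint)) (hS : IsUnitaryGroupGeneratedBy S JB)
    (hShat : IsStronglyContinuousGroup Shat) (hShat_ext : ∀ t h, Shat t (ι h) = ι (S t h))
    (hPhat : IsMeasurableLinearExtension γ ι (W.orthogonalProjectionOnto) Phat)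
    (hVγ : ∀ᵐ η ∂γ, η ∈ V) :
    ∃ Pm : X → W, Measurable Pm ∧ (∀ᵐ η ∂γ, Phat η = Pm η) ∧ ∀ᵐ η ∂γ,
      IsAdmissible C Shat Phat V η ∧
        ∀ᵐ t, bathForce C Shat Phat η t = C.adjoint (Pm (Shat t η) : H) := by
  have hG := hγ.isGaussian
  have hPm : AEMeasurable Phat γ := hPhat.measurable.aemeasurable
  have hL2 : MemLp Phat 2 γ := hPhat.memLp_two hγ hPm
  obtain ⟨Pm, hPmm, hPeq⟩ := hPm
  have hT : Measurable fun p : ℝ × X => Shat p.1 p.2 :=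
    measurable_uncurry_of_continuous_of_measurable hShat.continuous
      fun t => (Shat t).continuous.measurable
  have hTγ : ∀ t, MeasurePreserving (Shat t) γ γ := fun t =>
    hγ.measurePreserving (hS.unitary t) (hShat_ext t)
  refine ⟨Pm, hPmm, hPeq, ?_⟩
  filter_upwards [ae_ae_comp_of_measurePreserving hT hTγ hPeq,
    ae_ae_comp_of_measurePreserving hT hTγ hVγ,
    ae_memL2Loc_comp_of_measurePreserving hT hTγ hPmm (hL2.ae_eq hPeq)] with η h1 h2 h3
  have h4 : ∀ᵐ t, bathForce C Shat Phat η t = C.adjoint (Pm (Shat t η) : H) := by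
    filter_upwards [h1] with t ht
    rw [bathForce, ht]
  refine ⟨⟨?_, h2⟩, h4⟩
  have h5 : MemL2Loc fun t => C.adjoint (Pm (Shat t η) : H) := fun K hK =>
    (C.adjoint.comp W.subtypeL).comp_memLp' (h3 K hK)
  exact h5.congr_ae (by filter_upwards [h4] with t ht using ht.symm)

end Admissible

section Solution

variable [FiniteDimensional ℝ Z]

lemma isExtendedSolution_extendedFlow [FiniteDimensional ℝ W]
    (hgrad : ∃ K : ℝ≥0, LipschitzWith K (gradient HA))
    (hJA_lip : LocallyLipschitz JA) (hJA_bdd : ∃ M : ℝ, ∀ z, ‖JA z‖ ≤ M)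
    (hS : IsUnitaryGroupGeneratedBy S JB) (hShat : IsStronglyContinuousGroup Shat)
    (hShat_ext : ∀ t h, Shat t (ι h) = ι (S t h)) (hC : ∀ z, C z ∈ W)
    (hext : ∀ h, Phat (ι h) = W.orthogonalProjectionOnto h) (hV : ∀ h, ι h ∈ V)
    (hadd : ∀ x ∈ V, ∀ y ∈ V, Phat (x + y) = Phat x + Phat y) (z₀ : Z) {η₀ : X}
    (hη : IsAdmissible C Shat Phat V η₀) :
    IsExtendedSolution HA JA C S ι Shat Phat z₀ η₀
      (fun t => (extendedFlow HA JA C S ι Shat Phat V t (z₀, η₀)).1)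
      (fun t => (extendedFlow HA JA C S ι Shat Phat V t (z₀, η₀)).2) := by
  obtain ⟨v, hv⟩ := exists_isDrivenSolution (C := C) hgrad hJA_lip hJA_bdd hS z₀ hη.memL2Loc
  simp only [extendedFlow, if_pos hη]
  refine ⟨hv.position_zero, ?_, ?_, v, hv.isW12LocWithDeriv, ?_, fun t => ?_⟩
  · simp [hv.response_zero hS, hShat.zero]
  · exact (hShat.continuous η₀).add (ι.continuous.comp hv.continuous_response)
  -- Splitting `P̂(Ŝ_t η₀ + ι y_t)` requires `Ŝ_t η₀ ∈ V`, known only at a.e. time.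
  · filter_upwards [hη.ae_mem] with t ht
    rw [hv.velocity_eq, adjoint_extension_add hC hext hV hadd ht, add_assoc,
      add_comm (C.adjoint (bathResponse _ _ _ _ _ _ _))]
    rfl
  · rw [hv.response_eq, map_add ι, map_add (Shat t), hShat_ext, map_sub]
    abel

lemma exists_isFiniteEnergySolution_extendedFlow [FiniteDimensional ℝ W]
    (hgrad : ∃ K : ℝ≥0, LipschitzWith K (gradient HA))
    (hJA_lip : LocallyLipschitz JA) (hJA_bdd : ∃ M : ℝ, ∀ z, ‖JA z‖ ≤ M)
    (hS : IsUnitaryGroupGeneratedBy S JB)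
    (hShat_ext : ∀ t h, Shat t (ι h) = ι (S t h)) (hC : ∀ z, C z ∈ W)
    (hext : ∀ h, Phat (ι h) = W.orthogonalProjectionOnto h) (hV : ∀ h, ι h ∈ V)
    (z₀ : Z) (η₀ : H) :
    ∃ η : ℝ → H, (∀ t, ι (η t) = (extendedFlow HA JA C S ι Shat Phat V t (z₀, ι η₀)).2) ∧
      IsFiniteEnergySolution HA JA C S z₀ η₀
        (fun t => (extendedFlow HA JA C S ι Shat Phat V t (z₀, ι η₀)).1) η := by
  have hη := isAdmissible_coe hC hS hShat_ext hext hV η₀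
  obtain ⟨v, hv⟩ := exists_isDrivenSolution (C := C) hgrad hJA_lip hJA_bdd hS z₀ hη.memL2Loc
  obtain ⟨Kg, hKg⟩ := hgrad
  simp only [extendedFlow, if_pos hη]
  refine ⟨_, fun t => ?_, hv.isFiniteEnergySolution hS hKg.continuous hJA_lip.continuous
    (bathForce_coe hC hShat_ext hext η₀)⟩
  rw [map_add, hShat_ext]

/-- The map `θ` prepares the initial bath state and `g` is a Borel version of the resulting force.
At fixed time the flow is an a.e. limit of measurable iterates; continuity in time, valid also for
inadmissible states, then gives joint measurability. -/
lemma isMeasurableProcess_extendedFlow [MeasurableSpace Z] [BorelSpace Z]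
    [SecondCountableTopology H] [MeasurableSpace H] [BorelSpace H]
    [SecondCountableTopology X] [MeasurableSpace X] [BorelSpace X] {γ : Measure X}
    (hgrad : ∃ K : ℝ≥0, LipschitzWith K (gradient HA))
    (hJA_lip : LocallyLipschitz JA) (hJA_bdd : ∃ M : ℝ, ∀ z, ‖JA z‖ ≤ M)
    (hS : IsUnitaryGroupGeneratedBy S JB) (hShat : IsStronglyContinuousGroup Shat) (z₀ : Z)
    {θ : X → X} (hθ : AEMeasurable θ γ) {g : ℝ × X → Z} (hg : Measurable g)
    (hae : ∀ᵐ η ∂γ, IsAdmissible C Shat Phat V (θ η) ∧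
      ∀ᵐ t, bathForce C Shat Phat (θ η) t = g (t, η)) :
    IsMeasurableProcess γ fun t η => extendedFlow HA JA C S ι Shat Phat V t (z₀, θ η) := by
  have hcont : ∀ η, Continuous fun t => extendedFlow HA JA C S ι Shat Phat V t (z₀, η) := by
    intro η
    by_cases hη : IsAdmissible C Shat Phat V η
    · obtain ⟨v, hv⟩ := exists_isDrivenSolution (C := C) hgrad hJA_lip hJA_bdd hS z₀ hη.memL2Loc
      simp only [extendedFlow, if_pos hη]
      exact hv.continuous_position.prodMk
        ((hShat.continuous η).add (ι.continuous.comp hv.continuous_response))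
    · simp only [extendedFlow, if_neg hη]
      exact continuous_const
  obtain ⟨Kg, hKg⟩ := id hgrad
  have hfield : Measurable fun q : (ℝ × X) × (Z × H) =>
      interactionField HA JA C S (fun t => g (t, q.1.2)) q.1.1 q.2 :=
    (continuous_interactionField (C := C) hKg.continuous hJA_lip.continuous hS).measurable.comp
      ((measurable_fst.comp measurable_fst).prodMk
        (measurable_snd.prodMk (hg.comp measurable_fst)))
  have hlim : ∀ t, AEMeasurable (fun η => picardLimit
      (interactionField HA JA C S (bathForce C Shat Phat (θ η))) (z₀, C z₀) t) γ := by
    intro t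
    refine aemeasurable_of_tendsto_metrizable_ae atTop
      (f := fun n η => picardIter (interactionField HA JA C S fun t => g (t, η)) (z₀, C z₀) n t)
      (fun n => ((measurable_picardIter (F := fun η => interactionField HA JA C S fun t => g (t, η))
        hfield (z₀, C z₀) n).comp measurable_prodMk_left).aemeasurable) ?_
    filter_upwards [hae] with η hη
    obtain ⟨a, K, hF⟩ := exists_isCaratheodoryField (C := C) hgrad hJA_lip hJA_bdd hS hη.1.memL2Loc
    refine (hF.tendsto_picardIter (z₀, C z₀) t).congr fun n => picardIter_congr_ae ?_ _ _ _
    filter_upwards [hη.2] with s hs x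
    simp only [interactionField, hs]
  refine measurable_uncurry_of_continuous_of_measurable
    (u := fun (t : ℝ) (η : NullMeasurableSpace X γ) =>
      extendedFlow HA JA C S ι Shat Phat V t (z₀, θ η)) (fun η => hcont (θ η)) fun t => ?_
  have haem : AEMeasurable (fun η => extendedFlow HA JA C S ι Shat Phat V t (z₀, θ η)) γ := by
    have h1 := hlim t
    have h2 : AEMeasurable (fun η => Shat t (θ η)) γ :=
      (Shat t).continuous.measurable.comp_aemeasurable hθ
    have h3 : Measurable fun x : Z × H => ι (S t x.2 - C x.1) := by fun_prop
    refine (h1.fst.prodMk (h2.add (h3.comp_aemeasurable h1))).congr ?_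
    filter_upwards [hae] with η hη
    simp only [extendedFlow, if_pos hη.1]
    rfl
  exact fun s hs => haem.nullMeasurable hs

end Solution

end Flow

/-! ### Assembly of the three assertions. -/

theorem theoremt
    {Z H X : Type*}
    [NormedAddCommGroup Z] [InnerProductSpace ℝ Z] [CompleteSpace Z] [FiniteDimensional ℝ Z]
    [MeasurableSpace Z] [BorelSpace Z]
    [NormedAddCommGroup H] [InnerProductSpace ℝ H] [CompleteSpace H]
    [TopologicalSpace.SeparableSpace H] [MeasurableSpace H] [BorelSpace H]
    [NormedAddCommGroup X] [InnerProductSpace ℝ X] [CompleteSpace X]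
    [TopologicalSpace.SeparableSpace X] [MeasurableSpace X] [BorelSpace X]
    -- System A
    (HA : Z → ℝ) (hHA : ContDiff ℝ 2 HA)
    (hHA_lip : ∃ K : ℝ≥0, LipschitzWith K (gradient HA))
    (JA : Z → Z →L[ℝ] Z) (hJA_skew : ∀ z, (JA z).adjoint = -JA z)
    (hJA_lip : LocallyLipschitz JA) (hJA_bdd : ∃ M : ℝ, ∀ z, ‖JA z‖ ≤ M)
    -- heat bath at finite energy
    (JB : H →ₗ.[ℝ] H) (S : ℝ → H →L[ℝ] H) (hS : IsUnitaryGroupGeneratedBy S JB)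
    -- observable subspace and coupling
    (W : Submodule ℝ H) [FiniteDimensional ℝ W]
    (C : Z →L[ℝ] H) (hC : ∀ z, C z ∈ W)
    -- heat bath at positive temperature
    (ι : H →L[ℝ] X) (hι_inj : Function.Injective ι) (hι_HS : IsHilbertSchmidt ι)
    (Shat : ℝ → X →L[ℝ] X) (hShat : IsStronglyContinuousGroup Shat)
    (hShat_ext : ∀ t h, Shat t (ι h) = ι (S t h))
    (β : ℝ) (hβ : 0 < β) (γ : Measure X)
    (hγ : IsCenteredGaussian γ (β⁻¹ • ι.comp ι.adjoint))
    (Phat : X → W)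
    (hPhat : IsMeasurableLinearExtension γ ι (W.orthogonalProjectionOnto) Phat) :
    ∃ U : ℝ → Z × X → Z × X,
      -- finite-energy data
      (∀ (z₀ : Z) (η₀ : H), ∃ η : ℝ → H, (∀ t, ι (η t) = (U t (z₀, ι η₀)).2) ∧
        IsFiniteEnergySolution HA JA C S z₀ η₀ (fun t => (U t (z₀, ι η₀)).1) η) ∧
      -- random data distributed according to `γ`
      (∀ z₀ : Z,
        (∀ᵐ η₀ ∂γ, IsExtendedSolution HA JA C S ι Shat Phat z₀ η₀
          (fun t => (U t (z₀, η₀)).1) (fun t => (U t (z₀, η₀)).2)) ∧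
        IsMeasurableProcess γ (fun t η₀ => U t (z₀, η₀))) ∧
      -- fixed observable part `w₀`, random complementary part
      (∀ (z₀ : Z) (w₀ : W),
        (∀ᵐ ξ₀ ∂(γ.map (complProj ι Phat)),
          IsExtendedSolution HA JA C S ι Shat Phat z₀ (ι w₀ + ξ₀)
            (fun t => (U t (z₀, ι w₀ + ξ₀)).1) (fun t => (U t (z₀, ι w₀ + ξ₀)).2)) ∧
        IsMeasurableProcess γ (fun t η => U t (z₀, ι w₀ + complProj ι Phat η))) := by
  have := UniformSpace.secondCountable_of_separable H
  have := UniformSpace.secondCountable_of_separable X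
  have hG := hγ.isGaussian
  obtain ⟨V, hV, hVγ, hadd, -⟩ := hPhat.linear
  have hext := hPhat.extends_map
  obtain ⟨Pm, hPm, hPeq, hadm⟩ :=
    exists_measurable_bathForce (C := C) (V := V) hγ hS hShat hShat_ext hPhat hVγ
  have hT : Measurable fun p : ℝ × X => Shat p.1 p.2 :=
    measurable_uncurry_of_continuous_of_measurable hShat.continuous
      fun t => (Shat t).continuous.measurable
  have hforce : Measurable fun p : ℝ × X => C.adjoint (Pm (Shat p.1 p.2) : H) :=
    C.adjoint.continuous.measurable.comp (measurable_subtype_coe.comp (hPm.comp hT))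
  have hPhat_ae : AEMeasurable (complProj ι Phat) γ :=
    aemeasurable_id.sub (ι.continuous.measurable.comp_aemeasurable
      (measurable_subtype_coe.comp_aemeasurable hPhat.measurable.aemeasurable))
  have hshift : ∀ (w₀ : W) (η : X),
      ι w₀ + complProj ι Phat η = η + ι ((w₀ : H) - (Phat η : H)) := fun w₀ η => by
    rw [complProj, map_sub]; abel
  refine ⟨extendedFlow HA JA C S ι Shat Phat V, fun z₀ η₀ => ?_, fun z₀ => ⟨?_, ?_⟩,
    fun z₀ w₀ => ⟨?_, ?_⟩⟩
  · exact exists_isFiniteEnergySolution_extendedFlow hHA_lip hJA_lip hJA_bdd hS hShat_ext hC hext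
      hV z₀ η₀
  · filter_upwards [hadm] with η₀ hη₀
    exact isExtendedSolution_extendedFlow hHA_lip hJA_lip hJA_bdd hS hShat hShat_ext hC hext hV
      hadd z₀ hη₀.1
  · exact isMeasurableProcess_extendedFlow hHA_lip hJA_lip hJA_bdd hS hShat z₀ aemeasurable_id
      hforce hadm
  -- Being initial data of a solution is not known to be a measurable property, so the transfer to
  -- the image measure uses this lemma.
  · refine ae_map_of_ae_comp hPhat_ae ?_
    filter_upwards [hadm] with η hη
    refine isExtendedSolution_extendedFlow hHA_lip hJA_lip hJA_bdd hS hShat hShat_ext hC hext hV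
      hadd z₀ ?_
    rw [hshift]
    exact hη.1.add hC hS hShat_ext hext hV hadd _
  · have hresp : Measurable fun p : ℝ × X => C.adjoint (S p.1 ((w₀ : H) - (Pm p.2 : H))) :=
      C.adjoint.continuous.measurable.comp (hS.continuous_uncurry.measurable.comp
        (measurable_fst.prodMk (measurable_const.sub
          (measurable_subtype_coe.comp (hPm.comp measurable_snd)))))
    -- The force of the shifted state is that of `η` plus `C* S_t (w₀ - P̂η)`, with `Pm` in place of
    -- `P̂` in both terms.
    refine isMeasurableProcess_extendedFlow hHA_lip hJA_lip hJA_bdd hS hShat z₀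
      (aemeasurable_const.add hPhat_ae) (hforce.add hresp) ?_
    filter_upwards [hadm, hPeq] with η hη hηP
    simp only [Pi.add_apply, hshift]
    refine ⟨hη.1.add hC hS hShat_ext hext hV hadd _, ?_⟩
    filter_upwards [hη.2, hη.1.bathForce_add hC hShat_ext hext hV hadd
      ((w₀ : H) - (Phat η : H))] with t h1 h2
    rw [h2, h1, hηP]
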